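/- Let $\mathcal S$ be a smooth 3-dimensional manifold and $\mathbb S\to\mathcal S$ a smooth complex vector bundle of rank 2 (the bundle of contravariant spinors $\phi^A$). Let $\{e_{\mathbf k}[\lambda]\}_{\mathbf k=1,2,3}$ and $\{\epsilon_{\mathbf A}{}^A[\lambda]\}_{\mathbf A=0,1}$, $\lambda\in\mathbb R$, be smooth families of frames of $T\mathcal S$ and of $\mathbb S$ (smooth jointly in $\lambda$ and the point), with dual bases $\omega^{\mathbf k}{}_l[\lambda]$ and $\epsilon^{\mathbf A}{}_A[\lambda]$. They define families of - negative-definite Riemannian metrics $h_{kl}=-\sum_{\mathbf k}\omega^{\mathbf k}{}_k\omega^{\mathbf k}{}_l$, - spin metrics $\epsilon_{AB}=\epsilon_{\mathbf{AB}}\epsilon^{\mathbf A}{}_A\epsilon^{\mathbf B}{}_B$ with $(\epsilon_{\mathbf{AB}})=\begin{pmatrix}0&1\\-1&0\end{pmatrix}$, with inverse $\epsilon^{AB}=\epsilon^{\mathbf{AB}}\epsilon_{\mathbf A}{}^A\epsilon_{\mathbf B}{}^B$, $(\epsilon^{\mathbf{AB}})=\begin{pmatrix}0&1\\-1&0\end{pmatrix}$,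 and Hermitian products for which the dyad is orthonormal (so that $\mathbb S$ carries an $SU(2)$ structure), - soldering forms $\sigma^l{}_{AB}=\epsilon^{\mathbf C}{}_A\epsilon^{\mathbf D}{}_B\,e_{\mathbf k}{}^l\,\sigma^{\mathbf k}{}_{\mathbf{CD}}$, where the constants $\sigma^{\mathbf k}{}_{\mathbf{CD}}$ are given by $\beta_{\mathbf k}\sigma^{\mathbf k}{}_{\mathbf{CD}}=\frac1{\sqrt2}\begin{pmatrix}-\beta_{\mathbf 1}+i\beta_{\mathbf 2}&\beta_{\mathbf 3}\\ \beta_{\mathbf 3}&\beta_{\mathbf 1}+i\beta_{\mathbf 2}\end{pmatrix}$. Spinor indices are raised by $\psi^A=\epsilon^{AB}\psi_B$. Let $D=D[\lambda]$ be the Levi-Civita connection of $h_{kl}[\lambda]$ together with its spin connection, that is, the complex linear connection on $\mathbb S$ with $D\epsilon_{AB}=0$ and $D\sigma^k{}_{AB}=0$, and put $D_{AB}=\sigma^k{}_{AB}D_k$. Write $\delta=\frac{d}{d\lambda}\big|_{\lambda=0}$ and define, at $\lambda=0$, $$T_{ab}=h_{\mathbf{cd}}\,\omega^{\mathbf d}{}_{[a}\delta\omega^{\mathbf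 c}{}_{b]},\quad T_{AB}=T_{kl}\sigma^k{}_A{}^C\sigma^l{}_{BC},\quad S_{AB}=\epsilon_{\mathbf{CD}}\,\epsilon^{\mathbf D}{}_{(A}\delta\epsilon^{\mathbf C}{}_{B)},\quad \delta h_{ABCD}=\sigma^k{}_{AB}\sigma^l{}_{CD}\,\delta h_{kl},$$ where $h_{\mathbf{cd}}=-\delta_{\mathbf{cd}}$, and the modified variation of a family of covariant spinor fields, $$\vartheta\phi_A=\delta\phi_A+\tfrac14\,\delta\epsilon^B{}_B\,\phi_A+\tfrac12T_A{}^B\phi_B-S_A{}^B\phi_B,\qquad \delta\epsilon^B{}_B=\epsilon^{BA}\,\delta\epsilon_{AB},$$ extended to higher valence by the Leibniz rule. Then for every smooth family $\kappa_A[\lambda]$ of covariant spinor fields, $$\vartheta(D_{AB}\kappa_C)=D_{AB}\vartheta\kappa_C+\mathcal Q_{ABCD}\,\kappa^D-\tfrac12\,\delta h_{ABDF}\,D^{DF}\kappa_C,\qquad \mathcal Q_{ABCD}=-\tfrac12\,D_{(C}{}^{F}\delta h_{D)FAB},$$ where the objects on the right-hand side are those at $\lambda=0$. -/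

import Mathlib

open scoped Manifold ContDiff Bundle
open Module

noncomputable section

namespace SpaceSpinor

/-- Model space of a 3-manifold. -/
abbrev E3 : Type := EuclideanSpace ℝ (Fin 3)

/-- Model fibre of the spinor bundle. -/
abbrev C2 : Type := EuclideanSpace ℂ (Fin 2)

/-- The antisymmetric symbol `((0, 1), (-1, 0))`: it is the matrix of components both of `ε_{AB}`
and of `ε^{AB}` in a normalised spin dyad. Indices are raised by `ψ^A = ε^{AB} ψ_B`. -/
def epsSym (A B : Fin 2) : ℂ := !![0, 1; -1, 0] A B

/-- The spatial Infeld-van der Waerden symbols `σ^k_{AB}`: `β_{AB} = ∑ k, β_k σ^k_{AB}` is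
`2^{-1/2} ((-β₁ + i β₂, β₃), (β₃, β₁ + i β₂))`. -/
def ivdw (k : Fin 3) (A B : Fin 2) : ℂ :=
  ((Real.sqrt 2 : ℝ) : ℂ)⁻¹ *
    (![!![-1, 0; 0, 1], !![Complex.I, 0; 0, Complex.I], !![0, 1; 1, 0]] k : Matrix _ _ ℂ) A B

variable {M : Type*} [TopologicalSpace M] [ChartedSpace E3 M]
variable {S : M → Type*} [∀ x, AddCommGroup (S x)] [∀ x, Module ℂ (S x)]

/-- A field of covariant spinors `φ_{A₁ ⋯ Aₙ}` of valence `n`, as a function of `n` contravariant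
spinors (it is multilinear in them in all uses below). -/
abbrev SpinorField (S : M → Type*) (n : ℕ) : Type _ := ∀ x, (Fin n → S x) → ℂ

variable [∀ x, TopologicalSpace (S x)] [TopologicalSpace (Bundle.TotalSpace C2 S)]
  [∀ x, IsTopologicalAddGroup (S x)] [∀ x, ContinuousSMul ℝ (S x)]
  [FiberBundle C2 S] [VectorBundle ℂ C2 S] [VectorBundle ℝ C2 S]
  [IsManifold (𝓡 3) ∞ M] [ContMDiffVectorBundle ∞ C2 S (𝓡 3)]

variable (M S) in
/-- A smooth one-parameter family (the parameter `t` being the `λ` of the variation) of tensor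
frames `e_k` of `TM` and spin dyads `ε_A` of the bundle `S` of contravariant spinors. Metric,
spin metric, Hermitian product and soldering form are defined by declaring the frame orthonormal
and the dyad normalised, see `metric`, `eps`, `herm`, `solder` below. -/
structure Family where
  /-- the frame `e_k[t]`; its dual basis is the coframe `ω^k[t]` -/
  frame : ℝ → ∀ x : M, Basis (Fin 3) ℝ (TangentSpace (𝓡 3) x)
  /-- the contravariant dyad `ε_A[t]`; its dual basis is the covariant dyad `ε^A[t]` -/
  dyad : ℝ → ∀ x : M, Basis (Fin 2) ℂ (S x)
  frame_smooth : ∀ k, ContMDiff (𝓘(ℝ, ℝ).prod (𝓡 3)) ((𝓡 3).prod 𝓘(ℝ, E3)) ∞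
    (fun p : ℝ × M => (⟨p.2, frame p.1 p.2 k⟩ : Bundle.TotalSpace E3 (TangentSpace (𝓡 3) : M → Type)))
  dyad_smooth : ∀ A, ContMDiff (𝓘(ℝ, ℝ).prod (𝓡 3)) ((𝓡 3).prod 𝓘(ℝ, C2)) ∞
    (fun p : ℝ × M => (⟨p.2, dyad p.1 p.2 A⟩ : Bundle.TotalSpace C2 S))

namespace Family

variable (𝓕 : Family M S)

/-! ### Metric, spin metric, Hermitian product, soldering form -/

/-- The negative-definite metric `h_{ij}[t] = - ∑ k, ω^k_i ω^k_j`, for which the frame is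
orthonormal. -/
def metric (t : ℝ) (x : M) (X Y : TangentSpace (𝓡 3) x) : ℝ :=
  -∑ k, (𝓕.frame t x).coord k X * (𝓕.frame t x).coord k Y

/-- The spin metric `ε_{AB}[t]`, for which the dyad is normalised. -/
def eps (t : ℝ) (x : M) (u v : S x) : ℂ :=
  ∑ A, ∑ B, epsSym A B * (𝓕.dyad t x).coord A u * (𝓕.dyad t x).coord B v

/-- The Hermitian product `ϖ_{AA'} u^A v̄^{A'}`, whose matrix in the dyad is the identity. Together
with `eps` it reduces the structure group of `S` to `SU(2)`. -/
def herm (t : ℝ) (x : M) (u v : S x) : ℂ :=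
  ∑ A, (𝓕.dyad t x).coord A u * (starRingEnd ℂ) ((𝓕.dyad t x).coord A v)

/-- `ω^k_l σ^l_{AB} u^A v^B`: the `k`-th frame component of the complex vector `σ^l_{AB} u^A v^B`. -/
def solderCoeff (t : ℝ) (x : M) (k : Fin 3) (u v : S x) : ℂ :=
  ∑ A, ∑ B, ivdw k A B * (𝓕.dyad t x).coord A u * (𝓕.dyad t x).coord B v

/-- `β_{AB} u^A v^B` with `β_{AB} = σ^l_{AB} β_l`, for a complex-valued covector `β` at `x`. -/
def solder (t : ℝ) (x : M) (β : TangentSpace (𝓡 3) x → ℂ) (u v : S x) : ℂ :=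
  ∑ k, 𝓕.solderCoeff t x k u v * β (𝓕.frame t x k)

/-! ### Levi-Civita connection and spin connection -/

/-- `nab` is the Levi-Civita connection of `h_{ij}[t]`: torsion free and compatible with the
metric. -/
structure IsLeviCivita (t : ℝ)
    (nab : CovariantDerivative (𝓡 3) E3 (TangentSpace (𝓡 3) : M → Type)) : Prop where
  torsion_free : nab.torsion = 0
  metric_compatible : ∀ (Y Z : ∀ x : M, TangentSpace (𝓡 3) x) (x : M) (X : TangentSpace (𝓡 3) x),
    MDifferentiableAt (𝓡 3) ((𝓡 3).prod 𝓘(ℝ, E3))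
      (fun y => (⟨y, Y y⟩ : Bundle.TotalSpace E3 (TangentSpace (𝓡 3) : M → Type))) x →
    MDifferentiableAt (𝓡 3) ((𝓡 3).prod 𝓘(ℝ, E3))
      (fun y => (⟨y, Z y⟩ : Bundle.TotalSpace E3 (TangentSpace (𝓡 3) : M → Type))) x →
    mvfderiv (𝓡 3) (fun y => 𝓕.metric t y (Y y) (Z y)) x X =
      𝓕.metric t x (nab Y x X) (Z x) + 𝓕.metric t x (Y x) (nab Z x X)

/-- `D` is the spin connection on `S` induced by the Levi-Civita connection `nab` of `h_{ij}[t]`: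
the complex linear connection for which the spin metric `ε_{AB}` and the soldering form `σ^k_{AB}`
are parallel. Its values on differentiable sections are determined by these properties. -/
structure IsSpinConnection (t : ℝ)
    (nab : CovariantDerivative (𝓡 3) E3 (TangentSpace (𝓡 3) : M → Type))
    (D : CovariantDerivative (𝓡 3) C2 S) : Prop where
  complex_linear : ∀ (c : ℂ) (s : ∀ x, S x) (x : M) (X : TangentSpace (𝓡 3) x),
    MDifferentiableAt (𝓡 3) ((𝓡 3).prod 𝓘(ℝ, C2))
      (fun y => (⟨y, s y⟩ : Bundle.TotalSpace C2 S)) x →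
    D (c • s) x X = c • D s x X
  eps_parallel : ∀ (r s : ∀ x, S x) (x : M) (X : TangentSpace (𝓡 3) x),
    MDifferentiableAt (𝓡 3) ((𝓡 3).prod 𝓘(ℝ, C2))
      (fun y => (⟨y, r y⟩ : Bundle.TotalSpace C2 S)) x →
    MDifferentiableAt (𝓡 3) ((𝓡 3).prod 𝓘(ℝ, C2))
      (fun y => (⟨y, s y⟩ : Bundle.TotalSpace C2 S)) x →
    mvfderiv (𝓡 3) (fun y => 𝓕.eps t y (r y) (s y)) x X =
      𝓕.eps t x (D r x X) (s x) + 𝓕.eps t x (r x) (D s x X)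
  /-- `∇_X (σ(r, s)) = σ(D_X r, s) + σ(r, D_X s)`, in frame components -/
  solder_parallel : ∀ (r s : ∀ x, S x) (x : M) (X : TangentSpace (𝓡 3) x),
    MDifferentiableAt (𝓡 3) ((𝓡 3).prod 𝓘(ℝ, C2))
      (fun y => (⟨y, r y⟩ : Bundle.TotalSpace C2 S)) x →
    MDifferentiableAt (𝓡 3) ((𝓡 3).prod 𝓘(ℝ, C2))
      (fun y => (⟨y, s y⟩ : Bundle.TotalSpace C2 S)) x →
    ∀ k, mvfderiv (𝓡 3) (fun y => 𝓕.solderCoeff t y k (r y) (s y)) x X +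
        ∑ l, 𝓕.solderCoeff t x l (r x) (s x) *
          ((𝓕.frame t x).coord k (nab (fun y => 𝓕.frame t y l) x X) : ℂ) =
      𝓕.solderCoeff t x k (D r x X) (s x) + 𝓕.solderCoeff t x k (r x) (D s x X)

/-- The covariant derivative `(D_X φ)_{A₁ ⋯ Aₙ}` of a covariant spinor field, contracted with
contravariant spinors `u`: the Leibniz rule gives the components in the dyad, which are then
extended multilinearly. -/
def covDeriv (t : ℝ) (D : CovariantDerivative (𝓡 3) C2 S) {n : ℕ} (φ : SpinorField S n) (x : M)
    (X : TangentSpace (𝓡 3) x) (u : Fin n → S x) : ℂ :=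
  ∑ A : Fin n → Fin 2, (∏ i, (𝓕.dyad t x).coord (A i) (u i)) *
    (mvfderiv (𝓡 3) (fun y => φ y (fun i => 𝓕.dyad t y (A i))) x X -
      ∑ i, φ x (Function.update (fun j => 𝓕.dyad t x (A j)) i
        (D (fun y => 𝓕.dyad t y (A i)) x X)))

/-- `D_{AB} φ_{C₁ ⋯ Cₙ} = σ^k_{AB} D_k φ_{C₁ ⋯ Cₙ}`; the new indices come first. -/
def spinDeriv (t : ℝ) (D : CovariantDerivative (𝓡 3) C2 S) {n : ℕ} (φ : SpinorField S n) :
    SpinorField S (n + 2) := fun x u =>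
  𝓕.solder t x (fun X => 𝓕.covDeriv t D φ x X (fun i => u i.succ.succ)) (u 0) (u 1)

/-! ### Variations at `t = 0` -/

/-- The variation `δφ` of a family of covariant spinor fields. -/
def delta {n : ℕ} (φ : ℝ → SpinorField S n) : SpinorField S n := fun x u =>
  deriv (fun t => φ t x u) 0

/-- The variation `δ h_{kl}`. -/
def deltaMetric (x : M) (X Y : TangentSpace (𝓡 3) x) : ℝ :=
  deriv (fun t => 𝓕.metric t x X Y) 0

/-- The spinor `δ h_{ABCD} = σ^k_{AB} σ^l_{CD} δ h_{kl}`. -/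
def deltaMetricSpinor : SpinorField S 4 := fun x u =>
  𝓕.solder 0 x (fun X => 𝓕.solder 0 x (fun Y => (𝓕.deltaMetric x X Y : ℂ)) (u 2) (u 3)) (u 0) (u 1)

/-- The trace `δ ε^B_B = ε^{BA} δ ε_{AB}`. -/
def deltaEpsTrace (x : M) : ℂ :=
  ∑ A, ∑ B, epsSym B A * deriv (fun t => 𝓕.eps t x (𝓕.dyad 0 x A) (𝓕.dyad 0 x B)) 0

/-- The tensor frame gauge field `T_{ab} = h_{cd} ω^d_{[a} δ ω^c_{b]}`, with `h_{cd} = -δ_{cd}`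
the frame components of the metric. -/
def gaugeT (x : M) (X Y : TangentSpace (𝓡 3) x) : ℝ :=
  -(1 / 2) * ∑ c,
    ((𝓕.frame 0 x).coord c X * deriv (fun t => (𝓕.frame t x).coord c Y) 0 -
      (𝓕.frame 0 x).coord c Y * deriv (fun t => (𝓕.frame t x).coord c X) 0)

/-- The spinor `T_{AB} = T_{kl} σ^k_A^C σ^l_{BC}`, with `σ^k_A^C = ε^{CD} σ^k_{AD}`. -/
def gaugeTSpinor (x : M) (u v : S x) : ℂ :=
  ∑ C, ∑ D, epsSym C D *
    𝓕.solder 0 x (fun X => 𝓕.solder 0 x (fun Y => (𝓕.gaugeT x X Y : ℂ)) v (𝓕.dyad 0 x C))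
      u (𝓕.dyad 0 x D)

/-- The spin frame gauge field `S_{AB} = ε^D_{(A} δ ε^C_{B)} ε_{CD}`, where `C`, `D` label the
members of the covariant dyad. -/
def gaugeS (x : M) (u v : S x) : ℂ :=
  (1 / 2) * ∑ C, ∑ D, epsSym C D *
    ((𝓕.dyad 0 x).coord D u * deriv (fun t => (𝓕.dyad t x).coord C v) 0 +
      (𝓕.dyad 0 x).coord D v * deriv (fun t => (𝓕.dyad t x).coord C u) 0)

/-- For a covariant spinor `χ_{AB}`, the contravariant spinor `u^A χ_A^B = u^A ε^{BC} χ_{AC}`. -/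
def raiseSnd (x : M) (χ : S x → S x → ℂ) (u : S x) : S x :=
  ∑ B, (∑ C, epsSym B C * χ u (𝓕.dyad 0 x C)) • 𝓕.dyad 0 x B

/-- The modified variation
`ϑφ_A = δφ_A + (1/4) δε^B_B φ_A + (1/2) T_A^B φ_B - S_A^B φ_B`,
extended by the Leibniz rule to all covariant spinors: each index contributes the last three
terms. -/
def modVar {n : ℕ} (φ : ℝ → SpinorField S n) : SpinorField S n := fun x u =>
  delta φ x u + ∑ i,
    ((1 / 4) * 𝓕.deltaEpsTrace x * φ 0 x u +
      (1 / 2) * φ 0 x (Function.update u i (𝓕.raiseSnd x (𝓕.gaugeTSpinor x) (u i))) -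
      φ 0 x (Function.update u i (𝓕.raiseSnd x (𝓕.gaugeS x) (u i))))

/-- The spinor `Q_{ABCD} = -(1/2) D_{(C}^F δ h_{D)FAB}`, with `D_C^F = ε^{FG} D_{CG}`. -/
def Q (D : CovariantDerivative (𝓡 3) C2 S) : SpinorField S 4 := fun x u =>
  -(1 / 2) * ((1 / 2) * ∑ F, ∑ G, epsSym F G *
    (𝓕.spinDeriv 0 D 𝓕.deltaMetricSpinor x
        ![u 2, 𝓕.dyad 0 x G, u 3, 𝓕.dyad 0 x F, u 0, u 1] +
      𝓕.spinDeriv 0 D 𝓕.deltaMetricSpinor x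
        ![u 3, 𝓕.dyad 0 x G, u 2, 𝓕.dyad 0 x F, u 0, u 1]))

end Family

/-- A field of covectors `κ_A` on `S` as a covariant spinor field of valence 1. -/
def ofCovector (κ : ∀ x, Dual ℂ (S x)) : SpinorField S 1 := fun x u => κ x (u 0)

end SpaceSpinor

end

/-!
All objects are expressed by their components in the moving frame `e_i[t]` and the moving dyad
`ε_A[t]`, in which metric, spin metric and soldering form are constant. Three facts carry the proof.

*The modified variation is the variation of components, up to a rotation.* Write
`δe_i = b_i^j e_j` and split `b = s + r` into its symmetric and antisymmetric parts, so that
`δh_{ij} = 2 s_{ij}` and `T_{ij} = - r_{ij}`. Since `σ^k_{AB}` intertwines `so(3)` with `sl(2, ℂ)`,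
`T_A^B / 2 = - ρ(r)_A^B` for the spin representation `ρ` (`spinRep`). The terms `δε^B_B / 4` and
`- S_A^B` cancel the trace and the trace-free part of the change of the dyad. Hence `ϑφ` has the
components `δ(φ_A) - ρ(r)_A^B φ_B` (`coord_modVar`, `modVar_one`, `modVar_three`).

*The variation of the connection.* The Levi-Civita coefficients `γ_{ijk}` are antisymmetric in
`j, k`, and `γ_{ijk} - γ_{jik}` is the `k`-component of `[e_i, e_j]`. This bracket is computed with
the fixed connection at `t = 0`, which is torsion free as well; thus only the variation of `e_i`
and its first derivatives enter, and mixed partial derivatives commute. The Koszul formula gives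
`δγ_{ijk} = b_i^p γ_{pjk} + D_i r_{jk} + D_k s_{ij} - D_j s_{ik}` (`hasDerivAt_conn`).
The spin connection coefficients are `Γ_i = ρ(γ_i)` (`IsSpinConnection.spinConn_eq`), because the
`σ^k_{AB}` are constant and determine `ρ`. As `ρ` is a homomorphism of Lie algebras,
`δΓ_i = b_i^p Γ_p + ρ(∂_i r) + [ρ(r), Γ_i] + ρ(D_k s_{ij} - D_j s_{ik})` (`hasDerivAt_spinConn`).

*Comparison.* In `ϑ(D_{AB} κ_C)` the antisymmetric part of `b_i^p` is cancelled by the rotation of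
the pair `AB`, which leaves `s_i^p D_p κ_C`, the term with `δh_{ABDF} D^{DF} κ_C`
(`sum_eps_deltaMetricSpinor`). The terms with `ρ(r)` add up to the `ρ(r)`-part of `D_{AB} ϑκ_C`,
and `- ρ(D_k s_{ij} - D_j s_{ik})` is the curl of `δh`, that is `𝒬_{ABCD}` (`sum_eps_Q`).
-/

set_option linter.unusedSectionVars false

noncomputable section

namespace SpaceSpinor

/-! ### Smooth dependence of coordinates -/

/-- The coefficients of a smooth vector with respect to smooth vectors that form a basis at `p`
depend smoothly on the point near `p`: the map from coefficients to vectors is invertible, and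
inversion of continuous linear maps is smooth. Scalars may be real or complex, smoothness is real. -/
theorem contMDiffAt_coeff {EN HN N : Type*} [NormedAddCommGroup EN] [NormedSpace ℝ EN]
    [TopologicalSpace HN] {I : ModelWithCorners ℝ EN HN} [TopologicalSpace N] [ChartedSpace HN N]
    {K F ι : Type*} [RCLike K] [NormedAddCommGroup F] [NormedSpace ℝ F] [NormedSpace K F]
    [IsScalarTower ℝ K F] [Fintype ι] {B : N → ι → F} {w : N → F} {g : N → ι → K} {p : N}
    (hB : ∀ i, ContMDiffAt I 𝓘(ℝ, F) ∞ (fun q => B q i) p)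
    (hw : ContMDiffAt I 𝓘(ℝ, F) ∞ w p) (b₀ : Basis ι K F) (hb₀ : ∀ i, b₀ i = B p i)
    (hg : ∀ᶠ q in nhds p, w q = ∑ i, g q i • B q i) :
    ContMDiffAt I 𝓘(ℝ, ι → K) ∞ g p := by
  have : FiniteDimensional K F := b₀.finiteDimensional_of_finite
  let mk : ι → F →L[ℝ] ((ι → K) →L[K] F) := fun i =>
    ((ContinuousLinearMap.smulRightL K (ι → K) F
      (ContinuousLinearMap.proj (R := K) (φ := fun _ : ι => K) i)).restrictScalars ℝ)
  let T : N → ((ι → K) →L[K] F) := fun q => ∑ i, mk i (B q i)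
  have hT : ∀ q c, T q c = ∑ i, c i • B q i := by
    intro q c
    simp [T, mk]
  have hTs : ContMDiffAt I 𝓘(ℝ, (ι → K) →L[K] F) ∞ T p := by
    have : ∀ i, ContMDiffAt I 𝓘(ℝ, (ι → K) →L[K] F) ∞ (fun q => mk i (B q i)) p := fun i =>
      (mk i).contMDiff.contMDiffAt.comp p (hB i)
    exact ContMDiffAt.sum fun i _ => this i
  let e : (ι → K) ≃L[K] F := b₀.equivFun.symm.toContinuousLinearEquiv
  have he : (e : (ι → K) →L[K] F) = T p := by
    ext1 c
    simp [e, hT, Basis.equivFun_symm_apply, hb₀]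
  have hinv : ContMDiffAt I 𝓘(ℝ, F →L[K] (ι → K)) ∞ (fun q => (T q).inverse) p := by
    have h := (contDiffAt_map_inverse (𝕜 := K) (n := ∞) e).restrict_scalars ℝ
    rw [he] at h
    exact h.contMDiffAt.comp p hTs
  have hev : ∀ᶠ q in nhds p, T q ∈ Set.range
      (ContinuousLinearEquiv.toContinuousLinearMap : ((ι → K) ≃L[K] F) → _) :=
    hTs.continuousAt (by rw [← he]; exact ContinuousLinearEquiv.nhds e)
  have happ : ContMDiffAt I 𝓘(ℝ, ι → K) ∞ (fun q => (T q).inverse (w q)) p := by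
    have hb : ContDiff ℝ ∞ (fun z : (F →L[K] (ι → K)) × F => z.1 z.2) :=
      (isBoundedBilinearMap_apply (𝕜 := K)).contDiff.restrict_scalars ℝ
    exact hb.contDiffAt.contMDiffAt.comp p (hinv.prodMk_space hw)
  refine happ.congr_of_eventuallyEq ?_
  filter_upwards [hev, hg] with q ⟨e', he'⟩ hq
  rw [← he', ContinuousLinearMap.inverse_equiv, hq, ← hT, ← he']
  simp

/-- The coordinates of a smooth section along a map `f` in a smooth frame along `f` are smooth. -/
theorem contMDiff_coord {M : Type*} [TopologicalSpace M] [ChartedSpace E3 M]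
    {EN HN N : Type*} [NormedAddCommGroup EN] [NormedSpace ℝ EN]
    [TopologicalSpace HN] {I : ModelWithCorners ℝ EN HN} [TopologicalSpace N] [ChartedSpace HN N]
    {K F ι : Type*} [RCLike K] [NormedAddCommGroup F] [NormedSpace ℝ F] [NormedSpace K F]
    [IsScalarTower ℝ K F] [Fintype ι]
    {V : M → Type*} [TopologicalSpace (Bundle.TotalSpace F V)] [∀ x, AddCommGroup (V x)]
    [∀ x, Module K (V x)] [∀ x, TopologicalSpace (V x)] [FiberBundle F V] [VectorBundle K F V]
    {f : N → M} (b : ∀ q, Basis ι K (V (f q)))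
    (hb : ∀ i, ContMDiff I ((𝓡 3).prod 𝓘(ℝ, F)) ∞
      (fun q => (⟨f q, b q i⟩ : Bundle.TotalSpace F V)))
    (v : ∀ q, V (f q))
    (hv : ContMDiff I ((𝓡 3).prod 𝓘(ℝ, F)) ∞ (fun q => (⟨f q, v q⟩ : Bundle.TotalSpace F V)))
    (i : ι) : ContMDiff I 𝓘(ℝ, K) ∞ (fun q => (b q).coord i (v q)) := by
  intro p
  have hv' := Bundle.contMDiffAt_totalSpace.1 (hv p)
  set e := trivializationAt F V (f p) with he
  have hmem : f p ∈ e.baseSet := FiberBundle.mem_baseSet_trivializationAt' (f p)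
  have hev : ∀ᶠ q in nhds p, f q ∈ e.baseSet :=
    hv'.1.continuousAt (e.open_baseSet.mem_nhds hmem)
  have key : ContMDiffAt I 𝓘(ℝ, ι → K) ∞ (fun q i => (b q).coord i (v q)) p := by
    refine contMDiffAt_coeff (B := fun q i => (e ⟨f q, b q i⟩).2)
      (fun i => (Bundle.contMDiffAt_totalSpace.1 (hb i p)).2) hv'.2
      ((b p).map (e.linearEquivAt K (f p) hmem)) (fun i => ?_) ?_
    · simp only [Basis.map_apply]
      rfl
    · filter_upwards [hev] with q hq
      have h := congrArg (e.linearEquivAt K (f q) hq) ((b q).sum_repr (v q)).symm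
      rw [map_sum] at h
      simp only [map_smul] at h
      exact h
  exact (ContinuousLinearMap.proj (R := ℝ) (φ := fun _ : ι => K) i).contMDiff.contMDiffAt.comp p key

/-! ### Directional derivatives -/

section DirDeriv

variable {M : Type*} [TopologicalSpace M] [ChartedSpace E3 M]
variable {F : Type*} [NormedAddCommGroup F] [NormedSpace ℝ F]

/-- `f` is differentiable at `x`, and its derivative in the direction `X` is `f'`. -/
def HasDirDeriv (f : M → F) (x : M) (X : TangentSpace (𝓡 3) x) (f' : F) : Prop :=
  MDifferentiableAt (𝓡 3) 𝓘(ℝ, F) f x ∧ mvfderiv (𝓡 3) f x X = f'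

namespace HasDirDeriv

variable {f g : M → F} {x : M} {X : TangentSpace (𝓡 3) x} {f' g' : F}

theorem of_mdifferentiableAt (h : MDifferentiableAt (𝓡 3) 𝓘(ℝ, F) f x)
    (X : TangentSpace (𝓡 3) x) : HasDirDeriv f x X (mvfderiv (𝓡 3) f x X) := ⟨h, rfl⟩

theorem const (c : F) : HasDirDeriv (fun _ : M => c) x X 0 :=
  ⟨mdifferentiableAt_const, by rw [mvfderiv_const]; rfl⟩

theorem add (hf : HasDirDeriv f x X f') (hg : HasDirDeriv g x X g') :
    HasDirDeriv (fun y => f y + g y) x X (f' + g') :=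
  ⟨hf.1.add hg.1, by rw [mvfderiv_fun_add hf.1 hg.1, ← hf.2, ← hg.2]; rfl⟩

theorem clm_comp {G : Type*} [NormedAddCommGroup G] [NormedSpace ℝ G] (L : F →L[ℝ] G)
    (hf : HasDirDeriv f x X f') : HasDirDeriv (fun y => L (f y)) x X (L f') := by
  have h := L.hasMFDerivAt.comp x hf.1.hasMFDerivAt
  refine ⟨h.mdifferentiableAt, ?_⟩
  rw [← hf.2]
  simp only [mvfderiv]
  erw [h.mfderiv]
  rfl

theorem sum {ι : Type*} {s : Finset ι} {f : ι → M → F} {f' : ι → F}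
    (h : ∀ i ∈ s, HasDirDeriv (f i) x X (f' i)) :
    HasDirDeriv (fun y => ∑ i ∈ s, f i y) x X (∑ i ∈ s, f' i) := by
  classical
  induction s using Finset.induction_on with
  | empty => simpa using const 0
  | insert a s ha ih =>
    simp only [Finset.sum_insert ha]
    exact (h a (by simp)).add (ih fun i hi => h i (by simp [hi]))

theorem congr_deriv (hf : HasDirDeriv f x X f') (h : f' = g') : HasDirDeriv f x X g' := h ▸ hf

theorem ofReal {f : M → ℝ} {f' : ℝ} (hf : HasDirDeriv f x X f') :
    HasDirDeriv (fun y => (f y : ℂ)) x X (f' : ℂ) := hf.clm_comp Complex.ofRealCLM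

theorem const_mul {f : M → ℂ} {f' : ℂ} (c : ℂ) (hf : HasDirDeriv f x X f') :
    HasDirDeriv (fun y => c * f y) x X (c * f') :=
  hf.clm_comp (ContinuousLinearMap.mul ℝ ℂ c)

theorem const_mul_real {f : M → ℝ} {f' : ℝ} (c : ℝ) (hf : HasDirDeriv f x X f') :
    HasDirDeriv (fun y => c * f y) x X (c * f') :=
  hf.clm_comp (ContinuousLinearMap.mul ℝ ℝ c)

theorem mul {f g : M → ℂ} {f' g' : ℂ} (hf : HasDirDeriv f x X f') (hg : HasDirDeriv g x X g') :
    HasDirDeriv (fun y => f y * g y) x X (f' * g x + f x * g') := by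
  have h := hf.1.hasMFDerivAt.mul hg.1.hasMFDerivAt
  refine ⟨h.mdifferentiableAt, ?_⟩
  rw [← hf.2, ← hg.2]
  simp only [mvfderiv]
  erw [h.mfderiv]
  simp only [mul_comm (_ : ℂ) (g x), add_comm (g x * _)]
  rfl

end HasDirDeriv

end DirDeriv

/-! ### Mixed partial derivatives -/

/-- Symmetry of the second derivative of `G(t, z)`, in the form: the variation of the derivative
in `z` is the derivative in `z` of the variation. -/
theorem hasDerivAt_fderiv_swap {E F : Type*} [NormedAddCommGroup E] [NormedSpace ℝ E]
    [NormedAddCommGroup F] [NormedSpace ℝ F] {G : ℝ × E → F} {z : E}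
    (hG : ContDiffAt ℝ ∞ G (0, z)) (v : E) :
    DifferentiableAt ℝ (fun w => deriv (fun t => G (t, w)) 0) z ∧
    HasDerivAt (fun t => fderiv ℝ (fun w => G (t, w)) z v)
      (fderiv ℝ (fun w => deriv (fun t => G (t, w)) 0) z v) 0 := by
  have hev : ∀ᶠ p in nhds ((0 : ℝ), z), DifferentiableAt ℝ G p :=
    ((hG.of_le (by norm_num : (1 : WithTop ℕ∞) ≤ ∞)).eventually (by simp)).mono
      fun p hp => hp.differentiableAt one_ne_zero
  have h2 : DifferentiableAt ℝ (fderiv ℝ G) (0, z) :=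
    (hG.fderiv_right (m := 1) (by norm_num; exact WithTop.coe_le_coe.2 (le_top : (2 : ℕ∞) ≤ ⊤))).differentiableAt one_ne_zero
  have hsymm : IsSymmSndFDerivAt ℝ G (0, z) := hG.isSymmSndFDerivAt (by simp; exact WithTop.coe_le_coe.2 (le_top : (2 : ℕ∞) ≤ ⊤))
  have hz : ∀ᶠ w in nhds z, deriv (fun t => G (t, w)) 0 = fderiv ℝ G (0, w) (1, 0) := by
    have : Filter.Tendsto (fun w : E => ((0 : ℝ), w)) (nhds z) (nhds (0, z)) :=
      (by fun_prop : Continuous fun w : E => ((0 : ℝ), w)).tendsto z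
    filter_upwards [this.eventually hev] with w hw
    have h := hw.hasFDerivAt.comp_hasDerivAt (0 : ℝ)
      ((hasDerivAt_id (0 : ℝ)).prodMk (hasDerivAt_const (0 : ℝ) w))
    exact h.deriv
  have ht : ∀ᶠ t in nhds (0 : ℝ), fderiv ℝ (fun w => G (t, w)) z v = fderiv ℝ G (t, z) (0, v) := by
    have : Filter.Tendsto (fun t : ℝ => (t, z)) (nhds 0) (nhds (0, z)) :=
      (by fun_prop : Continuous fun t : ℝ => (t, z)).tendsto 0
    filter_upwards [this.eventually hev] with t ht
    have h := ht.hasFDerivAt.comp z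
      ((hasFDerivAt_const t z).prodMk (hasFDerivAt_id z))
    have h' : HasFDerivAt (fun w => G (t, w)) _ z := h
    rw [h'.fderiv]
    simp
  have hz' : HasFDerivAt (fun w => fderiv ℝ G (0, w) (1, 0))
      ((ContinuousLinearMap.apply ℝ F ((1 : ℝ), (0 : E))).comp
        ((fderiv ℝ (fderiv ℝ G) (0, z)).comp (ContinuousLinearMap.inr ℝ ℝ E))) z := by
    have h := h2.hasFDerivAt.comp z ((hasFDerivAt_const (0 : ℝ) z).prodMk (hasFDerivAt_id z))
    exact (ContinuousLinearMap.apply ℝ F ((1 : ℝ), (0 : E))).hasFDerivAt.comp z h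
  have hz'' := hz'.congr_of_eventuallyEq hz
  refine ⟨hz''.differentiableAt, ?_⟩
  have ht' : HasDerivAt (fun t => fderiv ℝ G (t, z) (0, v))
      (fderiv ℝ (fderiv ℝ G) (0, z) (1, 0) (0, v)) 0 := by
    have h := h2.hasFDerivAt.comp_hasDerivAt (0 : ℝ)
      ((hasDerivAt_id (0 : ℝ)).prodMk (hasDerivAt_const (0 : ℝ) z))
    exact (ContinuousLinearMap.apply ℝ F ((0 : ℝ), v)).hasFDerivAt.comp_hasDerivAt (0 : ℝ) h
  refine (ht'.congr_of_eventuallyEq ht).congr_deriv ?_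
  rw [hz''.fderiv, hsymm]
  rfl

section

variable {M : Type*} [TopologicalSpace M] [ChartedSpace E3 M] [IsManifold (𝓡 3) ∞ M]
  {F : Type*} [NormedAddCommGroup F] [NormedSpace ℝ F]

/-- On `ℝ × M`, the variation at `t = 0` commutes with directional derivatives on `M`. -/
theorem hasDerivAt_mvfderiv_swap {g : ℝ × M → F}
    (hg : ContMDiff (𝓘(ℝ, ℝ).prod (𝓡 3)) 𝓘(ℝ, F) ∞ g) (x : M) (X : TangentSpace (𝓡 3) x) :
    MDifferentiableAt (𝓡 3) 𝓘(ℝ, F) (fun y => deriv (fun t => g (t, y)) 0) x ∧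
    HasDerivAt (fun t => mvfderiv (𝓡 3) (fun y => g (t, y)) x X)
      (mvfderiv (𝓡 3) (fun y => deriv (fun t => g (t, y)) 0) x X) 0 := by
  set φ := extChartAt (𝓡 3) x
  have hsymm : ContMDiffAt 𝓘(ℝ, E3) (𝓡 3) ∞ φ.symm (φ x) :=
    (contMDiffOn_extChartAt_symm x).contMDiffAt (extChartAt_target_mem_nhds x)
  have hG : ContDiffAt ℝ ∞ (fun p : ℝ × E3 => g (p.1, φ.symm p.2)) (0, φ x) := by
    rw [← contMDiffAt_iff_contDiffAt]
    have h1 : ContMDiffAt 𝓘(ℝ, ℝ × E3) 𝓘(ℝ, ℝ) ∞ (fun p : ℝ × E3 => p.1) (0, φ x) :=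
      contDiff_fst.contMDiff.contMDiffAt
    have h2 : ContMDiffAt 𝓘(ℝ, ℝ × E3) 𝓘(ℝ, E3) ∞ (fun p : ℝ × E3 => p.2) (0, φ x) :=
      contDiff_snd.contMDiff.contMDiffAt
    exact hg.contMDiffAt.comp _ (h1.prodMk (hsymm.comp (0, φ x) h2))
  obtain ⟨h1, h2⟩ := hasDerivAt_fderiv_swap hG X
  have key : ∀ f : M → F, MDifferentiableAt (𝓡 3) 𝓘(ℝ, F) f x →
      mvfderiv (𝓡 3) f x X = fderiv ℝ (fun w => f (φ.symm w)) (φ x) X := by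
    intro f hf
    rw [hf.mvfderiv]
    simp only [writtenInExtChartAt, φ, Function.comp_def, extChartAt_model_space_eq_id,
      ModelWithCorners.range_eq_univ, fderivWithin_univ]
    rfl
  have hd : MDifferentiableAt (𝓡 3) 𝓘(ℝ, F) (fun y => deriv (fun t => g (t, y)) 0) x := by
    have h3 : MDifferentiableAt (𝓡 3) 𝓘(ℝ, E3) φ x :=
      (contMDiffAt_extChartAt (n := ∞)).mdifferentiableAt (by simp)
    refine (h1.mdifferentiableAt.comp x h3).congr_of_eventuallyEq ?_
    filter_upwards [extChartAt_source_mem_nhds (I := 𝓡 3) x] with y hy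
    simp [φ, (extChartAt (𝓡 3) x).left_inv hy, -extChartAt]
  refine ⟨hd, ?_⟩
  rw [key _ hd]
  refine h2.congr_of_eventuallyEq (.of_forall fun t => key _ ?_)
  have : ContMDiff (𝓡 3) 𝓘(ℝ, F) ∞ fun y => g (t, y) :=
    hg.comp (contMDiff_const.prodMk contMDiff_id)
  exact this.mdifferentiableAt (by simp)

theorem differentiableAt_slice {g : ℝ × M → F}
    (hg : ContMDiff (𝓘(ℝ, ℝ).prod (𝓡 3)) 𝓘(ℝ, F) ∞ g) (t : ℝ) (x : M) :
    DifferentiableAt ℝ (fun t => g (t, x)) t := by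
  have h : ContMDiff 𝓘(ℝ, ℝ) 𝓘(ℝ, F) ∞ (fun t => g (t, x)) :=
    hg.comp (contMDiff_id.prodMk contMDiff_const)
  exact (h.contDiff.differentiable (by simp)) t

end

/-! ### Algebra of the Infeld-van der Waerden symbols -/

/-- The constant `1 / √2`. -/
def invSqrtTwo : ℂ := ((Real.sqrt 2 : ℝ) : ℂ)⁻¹

theorem invSqrtTwo_sq : invSqrtTwo ^ 2 = 1 / 2 := by
  have h : ((Real.sqrt 2 : ℝ) : ℂ) ^ 2 = 2 := by
    rw [← Complex.ofReal_pow, Real.sq_sqrt (by norm_num)]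
    norm_num
  rw [invSqrtTwo, inv_pow, h]
  norm_num

theorem invSqrtTwo_ne_zero : invSqrtTwo ≠ 0 := by
  intro h
  have := invSqrtTwo_sq
  rw [h] at this
  norm_num at this

theorem ivdw_zero (A B : Fin 2) :
    ivdw 0 A B = (!![-invSqrtTwo, 0; 0, invSqrtTwo] : Matrix _ _ ℂ) A B := by
  fin_cases A <;> fin_cases B <;> simp [ivdw, invSqrtTwo]

theorem ivdw_one (A B : Fin 2) :
    ivdw 1 A B = (!![invSqrtTwo * Complex.I, 0; 0, invSqrtTwo * Complex.I] : Matrix _ _ ℂ) A B := by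
  fin_cases A <;> fin_cases B <;> simp [ivdw, invSqrtTwo]

theorem ivdw_two (A B : Fin 2) :
    ivdw 2 A B = (!![0, invSqrtTwo; invSqrtTwo, 0] : Matrix _ _ ℂ) A B := by
  fin_cases A <;> fin_cases B <;> simp [ivdw, invSqrtTwo]

/-- The spin representation `so(3) → sl(2, ℂ)`,
`ρ(g)_A^B = (1/2) ε^{BC} ε^{DE} g_{kl} σ^k_{AE} σ^l_{CD}`, of an antisymmetric matrix `g`. -/
def spinRep (g : Fin 3 → Fin 3 → ℂ) (A B : Fin 2) : ℂ :=
  (1 / 2) * ∑ k, ∑ l, g k l * ∑ C, ∑ D, ∑ E,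
    epsSym B C * epsSym D E * ivdw k A E * ivdw l C D

/-- The entries of `ρ(g)`; in particular `ρ(g)` is trace free. -/
theorem spinRep_apply {g : Fin 3 → Fin 3 → ℂ} (hg : ∀ k l, g k l = -g l k) (A B : Fin 2) :
    spinRep g A B = (!![-(Complex.I / 2) * g 1 0, (1 / 2) * (-g 0 2 + Complex.I * g 1 2);
      (1 / 2) * (g 0 2 + Complex.I * g 1 2), (Complex.I / 2) * g 1 0] : Matrix _ _ ℂ) A B := by
  have h0 : ∀ k, g k k = 0 := fun k => self_eq_neg.1 (hg k k)
  have h1 := hg 0 1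
  have h2 := hg 2 0
  have h3 := hg 2 1
  have hs := invSqrtTwo_sq
  have hI := Complex.I_sq
  fin_cases A <;> fin_cases B <;>
    simp [spinRep, Fin.sum_univ_succ, ivdw_zero, ivdw_one, ivdw_two, epsSym, h0, h1, h2, h3,
      -mul_eq_mul_left_iff] <;> grind

/-- The symbols `σ^k_{AB}` are invariant under `so(3)` acting through `spinRep` on spinors. -/
theorem sum_ivdw_mul {g : Fin 3 → Fin 3 → ℂ} (hg : ∀ k l, g k l = -g l k) (k : Fin 3)
    (A B : Fin 2) :
    ∑ l, ivdw l A B * g l k =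
      ∑ C, spinRep g A C * ivdw k C B + ∑ C, spinRep g B C * ivdw k A C := by
  have h0 : ∀ k, g k k = 0 := fun k => self_eq_neg.1 (hg k k)
  have h1 := hg 0 1
  have h2 := hg 2 0
  have h3 := hg 2 1
  have hI := Complex.I_sq
  fin_cases k <;> fin_cases A <;> fin_cases B <;>
    simp [Fin.sum_univ_succ, ivdw_zero, ivdw_one, ivdw_two, spinRep_apply hg, h0, h1, h2, h3] <;>
    grind

/-- The symbols `σ^k_{AB}` determine the spin representation. -/
theorem eq_spinRep {g : Fin 3 → Fin 3 → ℂ} (hg : ∀ k l, g k l = -g l k)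
    {G : Fin 2 → Fin 2 → ℂ}
    (hG : ∀ k A B, ∑ l, ivdw l A B * g l k = ∑ C, G A C * ivdw k C B + ∑ C, G B C * ivdw k A C)
    (A B : Fin 2) : G A B = spinRep g A B := by
  have hs := invSqrtTwo_ne_zero
  have h : ∀ k A B, ∑ C, (G A C - spinRep g A C) * ivdw k C B +
      ∑ C, (G B C - spinRep g B C) * ivdw k A C = 0 := by
    intro k A B
    have := (hG k A B).symm.trans (sum_ivdw_mul hg k A B)
    simp only [sub_mul, Finset.sum_sub_distrib]
    linear_combination this
  rw [← sub_eq_zero]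
  have h1 := h 0 0 0
  have h2 := h 0 1 1
  have h3 := h 2 0 0
  have h4 := h 2 1 1
  simp only [Fin.sum_univ_two, ivdw_zero, ivdw_two] at h1 h2 h3 h4
  simp [hs] at h1 h2 h3 h4
  fin_cases A <;> fin_cases B <;> simp <;> grind

/-- `ρ` is a homomorphism of Lie algebras. -/
theorem spinRep_lie {r g : Fin 3 → Fin 3 → ℂ} (hr : ∀ k l, r k l = -r l k)
    (hg : ∀ k l, g k l = -g l k) (A B : Fin 2) :
    spinRep (fun k l => ∑ m, r k m * g m l - ∑ m, g k m * r m l) A B =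
      ∑ C, spinRep r A C * spinRep g C B - ∑ C, spinRep g A C * spinRep r C B := by
  have h0 : ∀ k, g k k = 0 := fun k => self_eq_neg.1 (hg k k)
  have h1 := hg 0 1
  have h2 := hg 2 0
  have h3 := hg 2 1
  have h0' : ∀ k, r k k = 0 := fun k => self_eq_neg.1 (hr k k)
  have h1' := hr 0 1
  have h2' := hr 2 0
  have h3' := hr 2 1
  have hI := Complex.I_sq
  have ha : ∀ k l, ∑ m, r k m * g m l - ∑ m, g k m * r m l =
      -(∑ m, r l m * g m k - ∑ m, g l m * r m k) := by
    intro k l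
    rw [neg_sub, ← Finset.sum_sub_distrib, ← Finset.sum_sub_distrib]
    refine Finset.sum_congr rfl fun m _ => ?_
    rw [hr k m, hg m l, hg k m, hr m l]
    ring
  rw [spinRep_apply ha]
  fin_cases A <;> fin_cases B <;>
    simp [Fin.sum_univ_succ, spinRep_apply hg, spinRep_apply hr, h0, h1, h2,
      h0', h1', h2'] <;> grind

/-- The image under `ρ` of the antisymmetrization of `m_{pj}` in terms of the spinor
`m_{pj} σ^p_{AG} σ^j_{CF}`, contracted over one pair of indices and symmetrized in the other. -/
theorem spinRep_antisymmetrize (m : Fin 3 → Fin 3 → ℂ) (A B : Fin 2) :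
    spinRep (fun j k => m k j - m j k) A B =
      (1 / 2) * ∑ C, ∑ F, ∑ G, epsSym C B * epsSym F G * ∑ p, ∑ j,
        (ivdw p A G * ivdw j C F + ivdw p C G * ivdw j A F) * m p j := by
  rw [spinRep_apply (fun k l => by ring)]
  have hs := invSqrtTwo_sq
  have hI := Complex.I_sq
  fin_cases A <;> fin_cases B <;>
    simp [Fin.sum_univ_succ, ivdw_zero, ivdw_one, ivdw_two, epsSym,
      -mul_eq_mul_left_iff] <;> grind

/-- `σ^k_{AB} σ^{m AB} = - δ^{km}`. -/
theorem ivdw_contract (k m : Fin 3) :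
    ∑ A, ∑ B, ∑ G, ∑ H, epsSym A G * epsSym B H * ivdw k A B * ivdw m G H =
      if k = m then -1 else 0 := by
  have hs := invSqrtTwo_sq
  have hI := Complex.I_sq
  fin_cases k <;> fin_cases m <;>
    simp [Fin.sum_univ_succ, ivdw_zero, ivdw_one, ivdw_two, epsSym] <;> grind

theorem spinRep_add (g h : Fin 3 → Fin 3 → ℂ) (A B : Fin 2) :
    spinRep (fun k l => g k l + h k l) A B = spinRep g A B + spinRep h A B := by
  simp only [spinRep, add_mul, Finset.sum_add_distrib, mul_add]

theorem spinRep_sum_mul (c : Fin 3 → ℂ) (g : Fin 3 → Fin 3 → Fin 3 → ℂ)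
    (A B : Fin 2) :
    spinRep (fun k l => ∑ p, c p * g p k l) A B = ∑ p, c p * spinRep (g p) A B := by
  have hs : ∀ p, spinRep (fun k l => c p * g p k l) A B = c p * spinRep (g p) A B := by
    intro p
    simp only [spinRep, mul_assoc, ← Finset.mul_sum]
    ring
  simp only [Fin.sum_univ_three, spinRep_add, hs]

theorem hasDerivAt_spinRep {g : ℝ → Fin 3 → Fin 3 → ℂ} {g' : Fin 3 → Fin 3 → ℂ}
    {t : ℝ} (hg : ∀ k l, HasDerivAt (fun s => g s k l) (g' k l) t) (A B : Fin 2) :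
    HasDerivAt (fun s => spinRep (g s) A B) (spinRep g' A B) t :=
  .const_mul _ (.fun_sum fun k _ => .fun_sum fun l _ => (hg k l).mul_const _)

theorem HasDirDeriv.spinRep {M : Type*} [TopologicalSpace M] [ChartedSpace E3 M]
    {g : M → Fin 3 → Fin 3 → ℂ}
    {g' : Fin 3 → Fin 3 → ℂ} {x : M} {X : TangentSpace (𝓡 3) x}
    (hg : ∀ k l, HasDirDeriv (fun y => g y k l) x X (g' k l)) (A B : Fin 2) :
    HasDirDeriv (fun y => spinRep (g y) A B) x X (spinRep g' A B) := by
  simp only [SpaceSpinor.spinRep, mul_comm (g _ _ _), mul_comm (g' _ _)]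
  exact .const_mul _ (.sum fun k _ => .sum fun l _ => .const_mul _ (hg k l))

/-- The Koszul formula: an array antisymmetric in its last two indices is determined by its
antisymmetrization in the first two. -/
theorem koszul_unique {C X : Fin 3 → Fin 3 → Fin 3 → ℝ} (hX : ∀ i j k, X i j k = -X i k j)
    (hC : ∀ i j k, X i j k - X j i k = C i j k) (i j k : Fin 3) :
    X i j k = (1 / 2) * (C i j k - C j k i + C k i j) := by
  linarith [hC i j k, hC j k i, hC k i j, hX i j k, hX j k i, hX k i j, hX j i k, hX i k j,
    hX k j i]

/-! ### Finite sums -/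

theorem sum_fin_succ_fun {α β : Type*} [Fintype α] [AddCommMonoid β] {n : ℕ}
    (F : (Fin (n + 1) → α) → β) : ∑ A, F A = ∑ a, ∑ B, F (Fin.cons a B) := by
  rw [← (Fin.consEquiv fun _ => α).sum_comp, Fintype.sum_prod_type]
  rfl

theorem sum_fin_four_fun {α β : Type*} [Fintype α] [AddCommMonoid β]
    (F : α → α → α → α → β) :
    ∑ A : Fin 4 → α, F (A 0) (A 1) (A 2) (A 3) = ∑ a, ∑ b, ∑ c, ∑ d, F a b c d := by
  simp only [sum_fin_succ_fun, Fintype.sum_unique]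
  rfl

variable {M : Type*} [TopologicalSpace M] [ChartedSpace E3 M]
variable {S : M → Type*} [∀ x, AddCommGroup (S x)] [∀ x, Module ℂ (S x)]
variable [∀ x, TopologicalSpace (S x)] [TopologicalSpace (Bundle.TotalSpace C2 S)]
  [∀ x, IsTopologicalAddGroup (S x)] [∀ x, ContinuousSMul ℝ (S x)]
  [FiberBundle C2 S] [VectorBundle ℂ C2 S] [VectorBundle ℝ C2 S]
  [IsManifold (𝓡 3) ∞ M] [ContMDiffVectorBundle ∞ C2 S (𝓡 3)]

namespace Family

variable (𝓕 : Family M S)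

/-! ### Variation of the frames -/

theorem contMDiff_frame_section (t : ℝ) (k : Fin 3) :
    ContMDiff (𝓡 3) ((𝓡 3).prod 𝓘(ℝ, E3)) ∞ (fun y : M =>
      (⟨y, 𝓕.frame t y k⟩ : Bundle.TotalSpace E3 (TangentSpace (𝓡 3) : M → Type))) :=
  (𝓕.frame_smooth k).comp (contMDiff_const.prodMk contMDiff_id)

theorem contMDiff_dyad_section (t : ℝ) (A : Fin 2) :
    ContMDiff (𝓡 3) ((𝓡 3).prod 𝓘(ℝ, C2)) ∞ (fun y : M =>
      (⟨y, 𝓕.dyad t y A⟩ : Bundle.TotalSpace C2 S)) :=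
  (𝓕.dyad_smooth A).comp (contMDiff_const.prodMk contMDiff_id)

theorem mdifferentiableAt_frame (t : ℝ) (k : Fin 3) (x : M) :
    MDifferentiableAt (𝓡 3) ((𝓡 3).prod 𝓘(ℝ, E3)) (fun y : M =>
      (⟨y, 𝓕.frame t y k⟩ : Bundle.TotalSpace E3 (TangentSpace (𝓡 3) : M → Type))) x :=
  (𝓕.contMDiff_frame_section t k).mdifferentiableAt (by simp)

theorem mdifferentiableAt_dyad (t : ℝ) (A : Fin 2) (x : M) :
    MDifferentiableAt (𝓡 3) ((𝓡 3).prod 𝓘(ℝ, C2)) (fun y : M =>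
      (⟨y, 𝓕.dyad t y A⟩ : Bundle.TotalSpace C2 S)) x :=
  (𝓕.contMDiff_dyad_section t A).mdifferentiableAt (by simp)

/-- The components `a_i^j` of the frame `e_i[t] = a_i^j e_j[0]` in the unperturbed frame. -/
def frameCoeff (i j : Fin 3) (p : ℝ × M) : ℝ := (𝓕.frame 0 p.2).coord j (𝓕.frame p.1 p.2 i)

theorem contMDiff_frameCoeff (i j : Fin 3) :
    ContMDiff (𝓘(ℝ, ℝ).prod (𝓡 3)) 𝓘(ℝ, ℝ) ∞ (𝓕.frameCoeff i j) :=
  contMDiff_coord (f := fun p : ℝ × M => p.2) (fun p => 𝓕.frame 0 p.2)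
    (fun k => (𝓕.contMDiff_frame_section 0 k).comp contMDiff_snd) _ (𝓕.frame_smooth i) j

/-- The variation `δe_i = b_i^j e_j` of the frame. -/
def frameVar (i j : Fin 3) (x : M) : ℝ := deriv (fun t => 𝓕.frameCoeff i j (t, x)) 0

theorem hasDerivAt_frameCoeff (i j : Fin 3) (x : M) :
    HasDerivAt (fun t => 𝓕.frameCoeff i j (t, x)) (𝓕.frameVar i j x) 0 :=
  (differentiableAt_slice (𝓕.contMDiff_frameCoeff i j) 0 x).hasDerivAt

@[simp] theorem frameCoeff_zero (i j : Fin 3) (x : M) :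
    𝓕.frameCoeff i j (0, x) = if i = j then 1 else 0 := by
  simp [frameCoeff, Finsupp.single_apply]

theorem sum_frameCoeff (t : ℝ) (x : M) (i : Fin 3) :
    𝓕.frame t x i = ∑ j, 𝓕.frameCoeff i j (t, x) • 𝓕.frame 0 x j :=
  ((𝓕.frame 0 x).sum_repr _).symm

theorem differentiableAt_coord_frame (t : ℝ) (x : M) (k : Fin 3) (X : TangentSpace (𝓡 3) x) :
    DifferentiableAt ℝ (fun t => (𝓕.frame t x).coord k X) t := by
  have h : ContMDiff 𝓘(ℝ, ℝ) 𝓘(ℝ, ℝ) ∞ (fun t => (𝓕.frame t x).coord k X) :=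
    contMDiff_coord (V := (TangentSpace (𝓡 3) : M → Type)) (F := E3) (f := fun _ : ℝ => x)
      (fun t => 𝓕.frame t x)
      (fun k => (𝓕.frame_smooth k).comp (contMDiff_id.prodMk contMDiff_const)) (fun _ => X)
      contMDiff_const k
  exact (h.contDiff.differentiable (by simp)) t

theorem differentiableAt_coord_dyad (t : ℝ) (x : M) (A : Fin 2) (u : S x) :
    DifferentiableAt ℝ (fun t => (𝓕.dyad t x).coord A u) t := by
  have h : ContMDiff 𝓘(ℝ, ℝ) 𝓘(ℝ, ℂ) ∞ (fun t => (𝓕.dyad t x).coord A u) :=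
    contMDiff_coord (V := S) (F := C2) (f := fun _ : ℝ => x) (fun t => 𝓕.dyad t x)
      (fun A => (𝓕.dyad_smooth A).comp (contMDiff_id.prodMk contMDiff_const)) (fun _ => u)
      contMDiff_const A
  exact (h.contDiff.differentiable (by simp)) t

/-- The variation of the coframe is dual to that of the frame: `δω^k = - ω^j b_j^k`. -/
theorem hasDerivAt_coord_frame (x : M) (k : Fin 3) (X : TangentSpace (𝓡 3) x) :
    HasDerivAt (fun t => (𝓕.frame t x).coord k X)
      (-∑ j, (𝓕.frame 0 x).coord j X * 𝓕.frameVar j k x) 0 := by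
  have h1 := fun j => (𝓕.differentiableAt_coord_frame 0 x j X).hasDerivAt
  -- differentiate `ω^j[t](X) a_j^k(t) = ω^k[0](X)`
  have h2 : HasDerivAt (fun t => ∑ j, (𝓕.frame t x).coord j X * 𝓕.frameCoeff j k (t, x))
      (∑ j, (deriv (fun t => (𝓕.frame t x).coord j X) 0 * 𝓕.frameCoeff j k (0, x) +
        (𝓕.frame 0 x).coord j X * 𝓕.frameVar j k x)) 0 :=
    HasDerivAt.fun_sum fun j _ => (h1 j).mul (𝓕.hasDerivAt_frameCoeff j k x)
  have h3 : (fun t => ∑ j, (𝓕.frame t x).coord j X * 𝓕.frameCoeff j k (t, x)) =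
      fun _ => (𝓕.frame 0 x).coord k X := by
    funext t
    conv_rhs => rw [← (𝓕.frame t x).sum_repr X, map_sum]
    simp only [map_smul, smul_eq_mul]
    rfl
  rw [h3] at h2
  have h4 := h2.unique (hasDerivAt_const _ _)
  simp only [Finset.sum_add_distrib, frameCoeff_zero, mul_ite, mul_one, mul_zero,
    Finset.sum_ite_eq', Finset.mem_univ, if_true] at h4
  rw [← eq_neg_of_add_eq_zero_left h4]
  exact h1 k

theorem deltaMetric_frame (x : M) (i j : Fin 3) :
    𝓕.deltaMetric x (𝓕.frame 0 x i) (𝓕.frame 0 x j) = 𝓕.frameVar i j x + 𝓕.frameVar j i x := by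
  have h := (HasDerivAt.fun_sum (u := Finset.univ) fun k _ =>
    (𝓕.hasDerivAt_coord_frame x k (𝓕.frame 0 x i)).mul
      (𝓕.hasDerivAt_coord_frame x k (𝓕.frame 0 x j))).neg
  refine h.deriv.trans ?_
  simp [Finsupp.single_apply, Finset.sum_add_distrib, add_comm]

/-- In the frame, `T_{ij} = - r_{ij}`. -/
theorem gaugeT_frame (x : M) (i j : Fin 3) :
    𝓕.gaugeT x (𝓕.frame 0 x i) (𝓕.frame 0 x j) =
      -((𝓕.frameVar i j x - 𝓕.frameVar j i x) / 2) := by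
  simp only [gaugeT, (𝓕.hasDerivAt_coord_frame x _ _).deriv]
  simp [Finsupp.single_apply, Finset.sum_add_distrib]
  ring

/-! ### Variation of the Levi-Civita connection -/

/-- The connection coefficients `γ_{il}^k = ω^k(∇_{e_i} e_l)` of `nab` in the frame `e_i[t]`. -/
def conn (t : ℝ) (nab : CovariantDerivative (𝓡 3) E3 (TangentSpace (𝓡 3) : M → Type)) (x : M)
    (i l k : Fin 3) : ℝ :=
  (𝓕.frame t x).coord k (nab (fun y => 𝓕.frame t y l) x (𝓕.frame t x i))

variable {nab : CovariantDerivative (𝓡 3) E3 (TangentSpace (𝓡 3) : M → Type)}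

theorem metric_frame_right (t : ℝ) (x : M) (X : TangentSpace (𝓡 3) x) (k : Fin 3) :
    𝓕.metric t x X (𝓕.frame t x k) = -(𝓕.frame t x).coord k X := by
  simp [metric, Finsupp.single_apply]

theorem metric_frame_left (t : ℝ) (x : M) (X : TangentSpace (𝓡 3) x) (k : Fin 3) :
    𝓕.metric t x (𝓕.frame t x k) X = -(𝓕.frame t x).coord k X := by
  simp [metric, Finsupp.single_apply]

variable {𝓕} in
theorem IsLeviCivita.coord_frame_antisymm {t : ℝ} (h : 𝓕.IsLeviCivita t nab) (x : M)
    (X : TangentSpace (𝓡 3) x) (l k : Fin 3) :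
    (𝓕.frame t x).coord k (nab (fun y => 𝓕.frame t y l) x X) =
      -(𝓕.frame t x).coord l (nab (fun y => 𝓕.frame t y k) x X) := by
  have h1 := h.metric_compatible (fun y => 𝓕.frame t y l) (fun y => 𝓕.frame t y k) x X
    (𝓕.mdifferentiableAt_frame t l x) (𝓕.mdifferentiableAt_frame t k x)
  rw [metric_frame_right, metric_frame_left] at h1
  have h2 : (fun y => 𝓕.metric t y (𝓕.frame t y l) (𝓕.frame t y k)) =
      fun _ => -(if l = k then (1 : ℝ) else 0) := by
    funext y
    simp [metric_frame_right, Finsupp.single_apply]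
  rw [h2, mvfderiv_const] at h1
  change (0 : ℝ) = _ at h1
  linarith

variable {𝓕} in
theorem IsLeviCivita.conn_antisymm {t : ℝ} (h : 𝓕.IsLeviCivita t nab) (x : M) (i l k : Fin 3) :
    𝓕.conn t nab x i l k = -𝓕.conn t nab x i k l :=
  h.coord_frame_antisymm x _ l k

/-- The covariant derivative of the frame `e_j[t]` for a connection that is independent of `t`. -/
theorem nab_frame_eq (nab : CovariantDerivative (𝓡 3) E3 (TangentSpace (𝓡 3) : M → Type))
    (t : ℝ) (x : M) (X : TangentSpace (𝓡 3) x) (j : Fin 3) :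
    nab (fun y => 𝓕.frame t y j) x X =
      ∑ q, (𝓕.frameCoeff j q (t, x) • nab (fun y => 𝓕.frame 0 y q) x X +
        mvfderiv (𝓡 3) (fun y => 𝓕.frameCoeff j q (t, y)) x X • 𝓕.frame 0 x q) := by
  have hcov := nab.isCovariantDerivativeOn (s := Set.univ)
  have ha : ∀ q, MDifferentiableAt (𝓡 3) 𝓘(ℝ, ℝ) (fun y => 𝓕.frameCoeff j q (t, y)) x := by
    intro q
    have h : ContMDiff (𝓡 3) 𝓘(ℝ, ℝ) ∞ fun y => 𝓕.frameCoeff j q (t, y) :=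
      (𝓕.contMDiff_frameCoeff j q).comp (contMDiff_const.prodMk contMDiff_id)
    exact h.mdifferentiableAt (by simp)
  have hf := fun q => 𝓕.mdifferentiableAt_frame 0 q x
  have hs := fun q => (ha q).smul_section (hf q)
  have h1 : (fun y => 𝓕.frame t y j) =
      (((fun y => 𝓕.frameCoeff j 0 (t, y)) • fun y => 𝓕.frame 0 y 0) +
        ((fun y => 𝓕.frameCoeff j 1 (t, y)) • fun y => 𝓕.frame 0 y 1)) +
        ((fun y => 𝓕.frameCoeff j 2 (t, y)) • fun y => 𝓕.frame 0 y 2) := by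
    funext y
    rw [𝓕.sum_frameCoeff t y j, Fin.sum_univ_three]
    rfl
  rw [h1, hcov.add (mdifferentiableAt_add_section (hs 0) (hs 1)) (hs 2), hcov.add (hs 0) (hs 1),
    hcov.leibniz (hf 0) (ha 0), hcov.leibniz (hf 1) (ha 1), hcov.leibniz (hf 2) (ha 2),
    Fin.sum_univ_three]
  rfl

/-- The frame components `D_i b_j^k` of the covariant derivative of the variation of the frame. -/
def covFrameVar (nab : CovariantDerivative (𝓡 3) E3 (TangentSpace (𝓡 3) : M → Type)) (x : M)
    (i j k : Fin 3) : ℝ :=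
  mvfderiv (𝓡 3) (𝓕.frameVar j k) x (𝓕.frame 0 x i) +
    ∑ q, 𝓕.frameVar j q x * 𝓕.conn 0 nab x i q k - ∑ r, 𝓕.conn 0 nab x i j r * 𝓕.frameVar r k x

/-- `ω^k[t](∇_{e_i[t]} e_j[t])` for a fixed connection, expanded in the unperturbed frame. -/
theorem coord_nab_frame (nab : CovariantDerivative (𝓡 3) E3 (TangentSpace (𝓡 3) : M → Type))
    (t : ℝ) (x : M) (i j k : Fin 3) :
    (𝓕.frame t x).coord k (nab (fun y => 𝓕.frame t y j) x (𝓕.frame t x i)) =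
      ∑ q, ∑ p, 𝓕.frameCoeff i p (t, x) *
        (𝓕.frameCoeff j q (t, x) *
          (𝓕.frame t x).coord k (nab (fun y => 𝓕.frame 0 y q) x (𝓕.frame 0 x p)) +
        mvfderiv (𝓡 3) (fun y => 𝓕.frameCoeff j q (t, y)) x (𝓕.frame 0 x p) *
          (𝓕.frame t x).coord k (𝓕.frame 0 x q)) := by
  rw [nab_frame_eq, map_sum]
  refine Finset.sum_congr rfl fun q _ => ?_
  rw [𝓕.sum_frameCoeff t x i]
  simp only [map_add, map_sum, map_smul, smul_eq_mul, Finset.mul_sum, Finset.sum_mul, mul_add,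
    Finset.sum_add_distrib]
  congr 1
  · exact Finset.sum_congr rfl fun p _ => by ring
  · exact Finset.sum_congr rfl fun p _ => by ring

/-- For a connection that is independent of `t`, the variation of `ω^k(∇_{e_i} e_j)` is
`b_i^p γ_{pj}^k + D_i b_j^k`. -/
theorem hasDerivAt_coord_nab_frame
    (nab : CovariantDerivative (𝓡 3) E3 (TangentSpace (𝓡 3) : M → Type)) (x : M) (i j k : Fin 3) :
    HasDerivAt
      (fun t => (𝓕.frame t x).coord k (nab (fun y => 𝓕.frame t y j) x (𝓕.frame t x i)))
      (∑ p, 𝓕.frameVar i p x * 𝓕.conn 0 nab x p j k + 𝓕.covFrameVar nab x i j k) 0 := by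
  simp only [coord_nab_frame]
  have h := HasDerivAt.fun_sum (u := Finset.univ) fun q _ =>
    HasDerivAt.fun_sum (u := Finset.univ) fun p _ =>
      (𝓕.hasDerivAt_frameCoeff i p x).mul
        (((𝓕.hasDerivAt_frameCoeff j q x).mul
          (𝓕.hasDerivAt_coord_frame x k (nab (fun y => 𝓕.frame 0 y q) x (𝓕.frame 0 x p)))).add
        ((hasDerivAt_mvfderiv_swap (𝓕.contMDiff_frameCoeff j q) x (𝓕.frame 0 x p)).2.mul
          (𝓕.hasDerivAt_coord_frame x k (𝓕.frame 0 x q))))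
  refine h.congr_deriv ?_
  -- `a_i^j` is constant on `t = 0`, so only its mixed second derivative contributes
  have h0 : ∀ p q, mvfderiv (𝓡 3) (fun y : M => 𝓕.frameCoeff p q (0, y)) x = 0 := by
    intro p q
    simp only [frameCoeff_zero]
    exact mvfderiv_const _
  have h1 : ∀ q, (𝓕.frame 0 x).coord k (𝓕.frame 0 x q) = if q = k then 1 else 0 := by
    intro q
    simp [Finsupp.single_apply]
  have h2 : ∀ q, mvfderiv (𝓡 3) (fun y => deriv (fun t => 𝓕.frameCoeff j q (t, y)) 0) x
      (𝓕.frame 0 x i) = mvfderiv (𝓡 3) (𝓕.frameVar j q) x (𝓕.frame 0 x i) := fun _ => rfl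
  simp only [Pi.add_apply, Pi.mul_apply, h0, h1, zero_apply, zero_mul, add_zero]
  simp only [frameCoeff_zero, covFrameVar, conn, Finset.sum_add_distrib, ite_mul, mul_ite, one_mul,
    zero_mul, mul_zero, mul_one, Finset.sum_ite_irrel, Finset.sum_const_zero,
    Finset.sum_ite_eq, Finset.sum_ite_eq', Finset.mem_univ, if_true, mul_add]
  rw [h2]
  ring

/-- The variation of the Levi-Civita coefficients: with `b_{jk} = s_{jk} + r_{jk}` split into
symmetric and antisymmetric parts,
`δγ_{ijk} = b_i^p γ_{pjk} + D_i r_{jk} + D_k s_{ij} - D_j s_{ik}`. -/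
theorem hasDerivAt_conn {nab : ℝ → CovariantDerivative (𝓡 3) E3 (TangentSpace (𝓡 3) : M → Type)}
    (hnab : ∀ t, 𝓕.IsLeviCivita t (nab t)) (x : M) (i j k : Fin 3) :
    HasDerivAt (fun t => 𝓕.conn t (nab t) x i j k)
      (∑ p, 𝓕.frameVar i p x * 𝓕.conn 0 (nab 0) x p j k +
        (1 / 2) * (𝓕.covFrameVar (nab 0) x i j k - 𝓕.covFrameVar (nab 0) x i k j) +
        (1 / 2) * (𝓕.covFrameVar (nab 0) x k i j + 𝓕.covFrameVar (nab 0) x k j i) -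
        (1 / 2) * (𝓕.covFrameVar (nab 0) x j i k + 𝓕.covFrameVar (nab 0) x j k i)) 0 := by
  set C : ℝ → Fin 3 → Fin 3 → Fin 3 → ℝ := fun t i j k =>
    (𝓕.frame t x).coord k (nab 0 (fun y => 𝓕.frame t y j) x (𝓕.frame t x i)) -
      (𝓕.frame t x).coord k (nab 0 (fun y => 𝓕.frame t y i) x (𝓕.frame t x j)) with hC
  -- both `nab t` and `nab 0` are torsion free, so either computes the bracket `[e_i[t], e_j[t]]`
  have hconn : ∀ t i j k, 𝓕.conn t (nab t) x i j k - 𝓕.conn t (nab t) x j i k = C t i j k := by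
    intro t i j k
    have ht := (CovariantDerivative.torsion_eq_zero_iff _).1 (hnab t).torsion_free
      (𝓕.mdifferentiableAt_frame t i x) (𝓕.mdifferentiableAt_frame t j x)
    have h0 := (CovariantDerivative.torsion_eq_zero_iff _).1 (hnab 0).torsion_free
      (𝓕.mdifferentiableAt_frame t i x) (𝓕.mdifferentiableAt_frame t j x)
    simp only [conn, hC, ← map_sub]
    rw [ht, h0]
  have hder := fun i j k => (𝓕.hasDerivAt_coord_nab_frame (nab 0) x i j k).sub
    (𝓕.hasDerivAt_coord_nab_frame (nab 0) x j i k)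
  have hk : (fun t => 𝓕.conn t (nab t) x i j k) =
      fun t => (1 / 2) * (C t i j k - C t j k i + C t k i j) :=
    funext fun t => koszul_unique (fun i l k => (hnab t).conn_antisymm x i l k) (hconn t) i j k
  rw [hk]
  refine ((((hder i j k).sub (hder j k i)).add (hder k i j)).const_mul (1 / 2)).congr_deriv ?_
  have hP : ∀ i j k, ∑ p, 𝓕.frameVar i p x * 𝓕.conn 0 (nab 0) x p j k =
      -∑ p, 𝓕.frameVar i p x * 𝓕.conn 0 (nab 0) x p k j := by
    intro i j k
    rw [← Finset.sum_neg_distrib]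
    exact Finset.sum_congr rfl fun p _ => by rw [(hnab 0).conn_antisymm]; ring
  linarith [hP i j k, hP j k i, hP k i j]

/-! ### Spin connection coefficients -/

/-- The coefficients `Γ_{iA}^C = ε^C(D_{e_i} ε_A)` of a connection on spinors in the dyad
`ε_A[t]` and the frame `e_i[t]`. -/
def spinConn (t : ℝ) (D : CovariantDerivative (𝓡 3) C2 S) (x : M) (i : Fin 3) (A C : Fin 2) : ℂ :=
  (𝓕.dyad t x).coord C (D (fun y => 𝓕.dyad t y A) x (𝓕.frame t x i))

theorem coord_dyad (t : ℝ) (x : M) (A B : Fin 2) :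
    (𝓕.dyad t x).coord B (𝓕.dyad t x A) = if A = B then 1 else 0 := by
  simp [Finsupp.single_apply]

theorem solderCoeff_dyad_right (t : ℝ) (x : M) (k : Fin 3) (u : S x) (B : Fin 2) :
    𝓕.solderCoeff t x k u (𝓕.dyad t x B) = ∑ A, (𝓕.dyad t x).coord A u * ivdw k A B := by
  simp only [solderCoeff, coord_dyad, mul_ite, mul_one, mul_zero, Finset.sum_ite_eq,
    Finset.mem_univ, if_true]
  exact Finset.sum_congr rfl fun A _ => mul_comm _ _

theorem solderCoeff_dyad_left (t : ℝ) (x : M) (k : Fin 3) (u : S x) (A : Fin 2) :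
    𝓕.solderCoeff t x k (𝓕.dyad t x A) u = ∑ B, (𝓕.dyad t x).coord B u * ivdw k A B := by
  simp only [solderCoeff, coord_dyad, mul_ite, mul_one, mul_zero, ite_mul, zero_mul]
  rw [Finset.sum_comm]
  simp [mul_comm]

theorem solderCoeff_dyad (t : ℝ) (x : M) (k : Fin 3) (A B : Fin 2) :
    𝓕.solderCoeff t x k (𝓕.dyad t x A) (𝓕.dyad t x B) = ivdw k A B := by
  simp [solderCoeff_dyad_right, Finsupp.single_apply]

variable {𝓕} in
/-- The soldering form being parallel, in components: its covariant derivative along `e_i`. -/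
theorem IsSpinConnection.sum_ivdw_conn {t : ℝ}
    {nab : CovariantDerivative (𝓡 3) E3 (TangentSpace (𝓡 3) : M → Type)}
    {D : CovariantDerivative (𝓡 3) C2 S} (h : 𝓕.IsSpinConnection t nab D) (x : M)
    (i k : Fin 3) (A B : Fin 2) :
    ∑ l, ivdw l A B * (𝓕.conn t nab x i l k : ℂ) =
      ∑ C, 𝓕.spinConn t D x i A C * ivdw k C B + ∑ C, 𝓕.spinConn t D x i B C * ivdw k A C := by
  have h1 := h.solder_parallel (fun y => 𝓕.dyad t y A) (fun y => 𝓕.dyad t y B) x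
    (𝓕.frame t x i) (𝓕.mdifferentiableAt_dyad t A x) (𝓕.mdifferentiableAt_dyad t B x) k
  simp only [solderCoeff_dyad] at h1
  rw [mvfderiv_const, solderCoeff_dyad_left, solderCoeff_dyad_right] at h1
  rw [zero_apply, zero_add] at h1
  exact h1

variable {𝓕} in
/-- The spin connection coefficients are the image of the Levi-Civita coefficients under the spin
representation. -/
theorem IsSpinConnection.spinConn_eq {t : ℝ}
    {nab : CovariantDerivative (𝓡 3) E3 (TangentSpace (𝓡 3) : M → Type)}
    {D : CovariantDerivative (𝓡 3) C2 S} (h : 𝓕.IsSpinConnection t nab D)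
    (hnab : 𝓕.IsLeviCivita t nab) (x : M) (i : Fin 3) (A C : Fin 2) :
    𝓕.spinConn t D x i A C = spinRep (fun l k => (𝓕.conn t nab x i l k : ℂ)) A C :=
  eq_spinRep (fun k l => by rw [hnab.conn_antisymm]; push_cast; ring)
    (fun k A B => h.sum_ivdw_conn x i k A B) A C

/-! ### Modified variation in the moving frame -/

/-- The antisymmetric part `r_{kl}` of the variation of the frame; the gauge field `T_{kl}` is
`-r_{kl}`. -/
def rotVar (x : M) (k l : Fin 3) : ℂ := ((𝓕.frameVar k l x - 𝓕.frameVar l k x) / 2 : ℝ)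

theorem rotVar_antisymm (x : M) (k l : Fin 3) : 𝓕.rotVar x k l = -𝓕.rotVar x l k := by
  simp only [rotVar]
  push_cast
  ring

/-- The variation `ν_B^A = δε^A(ε_B)` of the covariant dyad, in components. -/
def dyadCoordVar (x : M) (B A : Fin 2) : ℂ :=
  deriv (fun t => (𝓕.dyad t x).coord A (𝓕.dyad 0 x B)) 0

theorem hasDerivAt_coord_dyad (x : M) (A : Fin 2) (u : S x) :
    HasDerivAt (fun t => (𝓕.dyad t x).coord A u)
      (∑ B, (𝓕.dyad 0 x).coord B u * 𝓕.dyadCoordVar x B A) 0 := by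
  have h : (fun t => (𝓕.dyad t x).coord A u) =
      fun t => ∑ B, (𝓕.dyad 0 x).coord B u * (𝓕.dyad t x).coord A (𝓕.dyad 0 x B) := by
    funext t
    conv_lhs => rw [← (𝓕.dyad 0 x).sum_repr u, map_sum]
    simp only [map_smul, smul_eq_mul]
    rfl
  rw [h]
  exact HasDerivAt.fun_sum fun B _ =>
    ((𝓕.differentiableAt_coord_dyad 0 x A (𝓕.dyad 0 x B)).hasDerivAt).const_mul _

theorem deltaEpsTrace_eq (x : M) : 𝓕.deltaEpsTrace x = -2 * ∑ A, 𝓕.dyadCoordVar x A A := by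
  have h : ∀ A B, deriv (fun t => 𝓕.eps t x (𝓕.dyad 0 x A) (𝓕.dyad 0 x B)) 0 =
      ∑ C, ∑ E, (epsSym C E * 𝓕.dyadCoordVar x A C * (if B = E then 1 else 0) +
        epsSym C E * (if A = C then 1 else 0) * 𝓕.dyadCoordVar x B E) := by
    intro A B
    have h := HasDerivAt.fun_sum (u := Finset.univ) fun C _ =>
      HasDerivAt.fun_sum (u := Finset.univ) fun E _ =>
        ((((𝓕.differentiableAt_coord_dyad 0 x C (𝓕.dyad 0 x A)).hasDerivAt).const_mul
          (epsSym C E)).mul ((𝓕.differentiableAt_coord_dyad 0 x E (𝓕.dyad 0 x B)).hasDerivAt))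
    simp only [coord_dyad] at h
    exact h.deriv
  simp only [deltaEpsTrace, h]
  simp [Fin.sum_univ_two, epsSym]
  ring

theorem coord_raiseSnd (x : M) (χ : S x → S x → ℂ) (u : S x) (A : Fin 2) :
    (𝓕.dyad 0 x).coord A (𝓕.raiseSnd x χ u) = ∑ C, epsSym A C * χ u (𝓕.dyad 0 x C) := by
  simp only [raiseSnd, map_sum, map_smul, coord_dyad, smul_eq_mul, mul_ite, mul_one, mul_zero,
    Finset.sum_ite_eq', Finset.mem_univ, if_true]

/-- `T_A^B / 2` is the rotation `- ρ(r)_A^B`. -/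
theorem coord_raiseSnd_gaugeTSpinor (x : M) (u : S x) (A : Fin 2) :
    (𝓕.dyad 0 x).coord A (𝓕.raiseSnd x (𝓕.gaugeTSpinor x) u) =
      -2 * ∑ B, (𝓕.dyad 0 x).coord B u * spinRep (𝓕.rotVar x) B A := by
  have hT : ∀ k l, ((𝓕.gaugeT x (𝓕.frame 0 x k) (𝓕.frame 0 x l) : ℝ) : ℂ) = -𝓕.rotVar x k l := by
    intro k l
    rw [gaugeT_frame, rotVar]
    push_cast
    ring
  simp only [coord_raiseSnd, gaugeTSpinor, solder, hT, solderCoeff_dyad]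
  simp only [solderCoeff_dyad_right, spinRep]
  generalize 𝓕.rotVar x = r
  fin_cases A <;> simp [Fin.sum_univ_two, epsSym] <;> simp only [Fin.sum_univ_three] <;> ring

/-- `S_A^B` is `ν_A^B` up to its trace: every 2 × 2 matrix with an index lowered is the sum of a
symmetric part and of a multiple of the spin metric. -/
theorem coord_raiseSnd_gaugeS (x : M) (u : S x) (A : Fin 2) :
    (𝓕.dyad 0 x).coord A (𝓕.raiseSnd x (𝓕.gaugeS x) u) =
      (1 / 4) * 𝓕.deltaEpsTrace x * (𝓕.dyad 0 x).coord A u +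
        ∑ B, (𝓕.dyad 0 x).coord B u * 𝓕.dyadCoordVar x B A := by
  simp only [coord_raiseSnd, gaugeS, deltaEpsTrace_eq, (𝓕.hasDerivAt_coord_dyad x _ _).deriv,
    coord_dyad]
  fin_cases A <;> simp [Fin.sum_univ_two, epsSym] <;> ring

/-- The variation of the dyad and the modification together act on an index as `- ρ(r)`. -/
theorem coord_modVar (x : M) (u : S x) (A : Fin 2) :
    ∑ B, (𝓕.dyad 0 x).coord B u * 𝓕.dyadCoordVar x B A +
        (1 / 4) * 𝓕.deltaEpsTrace x * (𝓕.dyad 0 x).coord A u +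
        (1 / 2) * (𝓕.dyad 0 x).coord A (𝓕.raiseSnd x (𝓕.gaugeTSpinor x) u) -
        (𝓕.dyad 0 x).coord A (𝓕.raiseSnd x (𝓕.gaugeS x) u) =
      -∑ B, (𝓕.dyad 0 x).coord B u * spinRep (𝓕.rotVar x) B A := by
  rw [coord_raiseSnd_gaugeTSpinor, coord_raiseSnd_gaugeS]
  ring

/-- The modified variation of `φ_A` in terms of its components in the moving dyad. -/
theorem modVar_one {x : M} {φ : ℝ → SpinorField S 1} {f : ℝ → Fin 2 → ℂ} {f' : Fin 2 → ℂ}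
    (hφ : ∀ t U, φ t x U = ∑ C, (𝓕.dyad t x).coord C (U 0) * f t C)
    (hf : ∀ C, HasDerivAt (fun t => f t C) (f' C) 0) (U : Fin 1 → S x) :
    𝓕.modVar φ x U = ∑ C, (𝓕.dyad 0 x).coord C (U 0) *
      (f' C - ∑ E, spinRep (𝓕.rotVar x) C E * f 0 E) := by
  have h := HasDerivAt.fun_sum (u := Finset.univ) fun C _ =>
    (𝓕.hasDerivAt_coord_dyad x C (U 0)).fun_mul (hf C)
  have h0 := 𝓕.coord_modVar x (U 0) 0
  have h1 := 𝓕.coord_modVar x (U 0) 1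
  simp only [modVar, delta, hφ, h.deriv]
  simp only [Fin.sum_univ_one, Function.update_self, Fin.sum_univ_two] at h0 h1 ⊢
  linear_combination f 0 0 * h0 + f 0 1 * h1

/-- A rotation of both spinor arguments acts on `σ^i(u, v)` as a rotation of the index `i`. -/
theorem sum_solderCoeff_rot {g : Fin 3 → Fin 3 → ℂ} (hg : ∀ k l, g k l = -g l k) (x : M)
    (i : Fin 3) (u v : S x) :
    ∑ A, ∑ B, ivdw i A B *
        ((∑ E, (𝓕.dyad 0 x).coord E u * spinRep g E A) * (𝓕.dyad 0 x).coord B v +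
          (𝓕.dyad 0 x).coord A u * ∑ E, (𝓕.dyad 0 x).coord E v * spinRep g E B) =
      ∑ l, 𝓕.solderCoeff 0 x l u v * g l i := by
  have h := sum_ivdw_mul hg i
  have e : ∑ l, 𝓕.solderCoeff 0 x l u v * g l i =
      ∑ A, ∑ B, (∑ l, ivdw l A B * g l i) *
        ((𝓕.dyad 0 x).coord A u * (𝓕.dyad 0 x).coord B v) := by
    simp only [solderCoeff, Fin.sum_univ_two, Fin.sum_univ_three]
    ring
  rw [e]
  simp only [h, Fin.sum_univ_two]
  ring

/-- The modified variation of `σ^i_{AB} f_{iC}`, with `f_{iC}` the components in the moving frame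
and dyad. -/
theorem modVar_three {x : M} {φ : ℝ → SpinorField S 3} {f : ℝ → Fin 3 → Fin 2 → ℂ}
    {f' : Fin 3 → Fin 2 → ℂ}
    (hφ : ∀ t U, φ t x U = ∑ i, 𝓕.solderCoeff t x i (U 0) (U 1) *
      ∑ C, (𝓕.dyad t x).coord C (U 2) * f t i C)
    (hf : ∀ i C, HasDerivAt (fun t => f t i C) (f' i C) 0) (U : Fin 3 → S x) :
    𝓕.modVar φ x U = ∑ i, 𝓕.solderCoeff 0 x i (U 0) (U 1) *
      ∑ C, (𝓕.dyad 0 x).coord C (U 2) *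
        (f' i C - ∑ l, 𝓕.rotVar x i l * f 0 l C - ∑ E, spinRep (𝓕.rotVar x) C E * f 0 i E) := by
  have h := HasDerivAt.fun_sum (u := Finset.univ) fun i _ =>
    (HasDerivAt.fun_sum (u := Finset.univ) fun A _ =>
      HasDerivAt.fun_sum (u := Finset.univ) fun B _ =>
        ((𝓕.hasDerivAt_coord_dyad x A (U 0)).const_mul (ivdw i A B)).fun_mul
          (𝓕.hasDerivAt_coord_dyad x B (U 1))).fun_mul
    (HasDerivAt.fun_sum (u := Finset.univ) fun C _ =>
      (𝓕.hasDerivAt_coord_dyad x C (U 2)).fun_mul (hf i C))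
  -- solved for the variation of the dyad, the modification cancels and `-ρ(r)` is left
  have hν : ∀ u A, ∑ B, (𝓕.dyad 0 x).coord B u * 𝓕.dyadCoordVar x B A =
      -∑ B, (𝓕.dyad 0 x).coord B u * spinRep (𝓕.rotVar x) B A -
        (1 / 4) * 𝓕.deltaEpsTrace x * (𝓕.dyad 0 x).coord A u -
        (1 / 2) * (𝓕.dyad 0 x).coord A (𝓕.raiseSnd x (𝓕.gaugeTSpinor x) u) +
        (𝓕.dyad 0 x).coord A (𝓕.raiseSnd x (𝓕.gaugeS x) u) := fun u A => by
    linear_combination 𝓕.coord_modVar x u A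
  have key : 𝓕.modVar φ x U = ∑ i,
      ((-∑ A, ∑ B, ivdw i A B *
        ((∑ E, (𝓕.dyad 0 x).coord E (U 0) * spinRep (𝓕.rotVar x) E A) *
            (𝓕.dyad 0 x).coord B (U 1) +
          (𝓕.dyad 0 x).coord A (U 0) *
            ∑ E, (𝓕.dyad 0 x).coord E (U 1) * spinRep (𝓕.rotVar x) E B)) *
        ∑ C, (𝓕.dyad 0 x).coord C (U 2) * f 0 i C +
      𝓕.solderCoeff 0 x i (U 0) (U 1) * ∑ C, ((𝓕.dyad 0 x).coord C (U 2) * f' i C -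
        (∑ E, (𝓕.dyad 0 x).coord E (U 2) * spinRep (𝓕.rotVar x) E C) * f 0 i C)) := by
    have e : ∀ (i : Fin 3) (a : S x), Function.update U i a 0 = (if i = 0 then a else U 0) ∧
        Function.update U i a 1 = (if i = 1 then a else U 1) ∧
        Function.update U i a 2 = (if i = 2 then a else U 2) := by
      intro i a
      fin_cases i <;> simp
    simp only [modVar, delta, hφ, solderCoeff, h.deriv, (e _ _).1, (e _ _).2.1, (e _ _).2.2, hν]
    generalize 𝓕.deltaEpsTrace x = τ
    generalize spinRep (𝓕.rotVar x) = R
    simp only [Fin.sum_univ_three, Fin.sum_univ_two, Fin.reduceEq, if_true, if_false]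
    ring
  rw [key]
  simp only [𝓕.sum_solderCoeff_rot (𝓕.rotVar_antisymm x)]
  generalize spinRep (𝓕.rotVar x) = R
  have h0 : ∀ k, 𝓕.rotVar x k k = 0 := fun k => self_eq_neg.1 (𝓕.rotVar_antisymm x k k)
  simp only [Fin.sum_univ_three, Fin.sum_univ_two, h0, 𝓕.rotVar_antisymm x 1 0,
    𝓕.rotVar_antisymm x 2 0, 𝓕.rotVar_antisymm x 2 1]
  ring

/-- `D_{AB} φ_C` in terms of the components of `φ_C` in the dyad. -/
theorem spinDeriv_one {x : M} {t : ℝ} {D : CovariantDerivative (𝓡 3) C2 S} {φ : SpinorField S 1}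
    {f : Fin 2 → M → ℂ} (hφ : ∀ y U, φ y U = ∑ C, (𝓕.dyad t y).coord C (U 0) * f C y)
    (U : Fin 3 → S x) :
    𝓕.spinDeriv t D φ x U = ∑ i, 𝓕.solderCoeff t x i (U 0) (U 1) *
      ∑ C, (𝓕.dyad t x).coord C (U 2) * (mvfderiv (𝓡 3) (f C) x (𝓕.frame t x i) -
        ∑ E, 𝓕.spinConn t D x i C E * f E x) := by
  simp only [spinDeriv, solder, covDeriv, hφ, coord_dyad]
  refine Finset.sum_congr rfl fun i _ => ?_
  congr 1
  rw [← (Equiv.funUnique (Fin 1) (Fin 2)).symm.sum_comp]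
  refine Finset.sum_congr rfl fun C _ => ?_
  simp [spinConn]

/-! ### The spinor of the metric variation -/

/-- The frame components of `δh_{ij}`. -/
def metricVar (x : M) (i j : Fin 3) : ℝ := 𝓕.frameVar i j x + 𝓕.frameVar j i x

theorem deltaMetricSpinor_eq (x : M) (U : Fin 4 → S x) :
    𝓕.deltaMetricSpinor x U = ∑ i, ∑ j, 𝓕.solderCoeff 0 x i (U 0) (U 1) *
      𝓕.solderCoeff 0 x j (U 2) (U 3) * (𝓕.metricVar x i j : ℂ) := by
  simp only [deltaMetricSpinor, solder, deltaMetric_frame, metricVar, Finset.mul_sum, mul_assoc]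

theorem mdifferentiableAt_frameVar (i j : Fin 3) (x : M) :
    MDifferentiableAt (𝓡 3) 𝓘(ℝ, ℝ) (𝓕.frameVar i j) x :=
  (hasDerivAt_mvfderiv_swap (𝓕.contMDiff_frameCoeff i j) x 0).1

/-- The components of `D_p δh_{ij}`, written through `D_p b_{ij}`. -/
def covMetricVar (nab : CovariantDerivative (𝓡 3) E3 (TangentSpace (𝓡 3) : M → Type)) (x : M)
    (p i j : Fin 3) : ℝ := 𝓕.covFrameVar nab x p i j + 𝓕.covFrameVar nab x p j i

/-- `D_p δh_{ij} = ∂_p δh_{ij} - γ_{pi}^l δh_{lj} - γ_{pj}^l δh_{il}`. -/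
theorem covMetricVar_eq {nab : CovariantDerivative (𝓡 3) E3 (TangentSpace (𝓡 3) : M → Type)}
    (hnab : 𝓕.IsLeviCivita 0 nab) (x : M) (p i j : Fin 3) :
    𝓕.covMetricVar nab x p i j =
      (mvfderiv (𝓡 3) (𝓕.frameVar i j) x (𝓕.frame 0 x p) +
        mvfderiv (𝓡 3) (𝓕.frameVar j i) x (𝓕.frame 0 x p)) -
      ∑ l, 𝓕.conn 0 nab x p i l * 𝓕.metricVar x l j -
      ∑ l, 𝓕.conn 0 nab x p j l * 𝓕.metricVar x i l := by
  simp only [covMetricVar, covFrameVar, metricVar, hnab.conn_antisymm x p _ j,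
    hnab.conn_antisymm x p _ i, Fin.sum_univ_three]
  ring

/-- Since the soldering form is parallel, the derivative of the spinor `δh_{ABCD}` is the spinor
of the tensor `D_p δh_{ij}`. -/
theorem spinDeriv_deltaMetricSpinor
    {nab : CovariantDerivative (𝓡 3) E3 (TangentSpace (𝓡 3) : M → Type)}
    {D : CovariantDerivative (𝓡 3) C2 S} (hnab : 𝓕.IsLeviCivita 0 nab)
    (hD : 𝓕.IsSpinConnection 0 nab D) (x : M) (U : Fin 6 → S x) :
    𝓕.spinDeriv 0 D 𝓕.deltaMetricSpinor x U =
      ∑ p, 𝓕.solderCoeff 0 x p (U 0) (U 1) * ∑ i, ∑ j, 𝓕.solderCoeff 0 x i (U 2) (U 3) *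
        𝓕.solderCoeff 0 x j (U 4) (U 5) * (𝓕.covMetricVar nab x p i j : ℂ) := by
  simp only [spinDeriv, solder]
  refine Finset.sum_congr rfl fun p _ => ?_
  congr 1
  have hcomp : ∀ A : Fin 4 → Fin 2,
      mvfderiv (𝓡 3) (fun y => 𝓕.deltaMetricSpinor y (fun i => 𝓕.dyad 0 y (A i))) x
          (𝓕.frame 0 x p) -
        ∑ i, 𝓕.deltaMetricSpinor x (Function.update (fun j => 𝓕.dyad 0 x (A j)) i
          (D (fun y => 𝓕.dyad 0 y (A i)) x (𝓕.frame 0 x p))) =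
      ∑ i, ∑ j, ivdw i (A 0) (A 1) * ivdw j (A 2) (A 3) * (𝓕.covMetricVar nab x p i j : ℂ) := by
    intro A
    have hder : HasDirDeriv (fun y => 𝓕.deltaMetricSpinor y (fun i => 𝓕.dyad 0 y (A i))) x
        (𝓕.frame 0 x p) (∑ i, ∑ j, ivdw i (A 0) (A 1) * ivdw j (A 2) (A 3) *
          ((mvfderiv (𝓡 3) (𝓕.frameVar i j) x (𝓕.frame 0 x p) +
            mvfderiv (𝓡 3) (𝓕.frameVar j i) x (𝓕.frame 0 x p) : ℝ) : ℂ)) := by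
      simp only [deltaMetricSpinor_eq, solderCoeff_dyad]
      exact .sum fun i _ => .sum fun j _ => .const_mul _ (.ofReal
        ((HasDirDeriv.of_mdifferentiableAt (𝓕.mdifferentiableAt_frameVar i j x) _).add
          (.of_mdifferentiableAt (𝓕.mdifferentiableAt_frameVar j i x) _)))
    have e : ∀ (V : Fin 4 → S x) (i : Fin 4) (a : S x),
        Function.update V i a 0 = (if i = 0 then a else V 0) ∧
        Function.update V i a 1 = (if i = 1 then a else V 1) ∧
        Function.update V i a 2 = (if i = 2 then a else V 2) ∧
        Function.update V i a 3 = (if i = 3 then a else V 3) := by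
      intro V i a
      fin_cases i <;> simp
    -- `σ^i` is parallel, solved for the derivative of the first argument
    have hs : ∀ i B C,
        𝓕.solderCoeff 0 x i (D (fun y => 𝓕.dyad 0 y B) x (𝓕.frame 0 x p)) (𝓕.dyad 0 x C) =
        ∑ l, ivdw l B C * (𝓕.conn 0 nab x p l i : ℂ) -
        𝓕.solderCoeff 0 x i (𝓕.dyad 0 x B) (D (fun y => 𝓕.dyad 0 y C) x (𝓕.frame 0 x p)) := by
      intro i B C
      rw [hD.sum_ivdw_conn, solderCoeff_dyad_left, solderCoeff_dyad_right]
      simp only [spinConn, add_sub_cancel_right]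
    rw [hder.2]
    simp only [deltaMetricSpinor_eq, (e _ _ _).1, (e _ _ _).2.1, (e _ _ _).2.2.1,
      (e _ _ _).2.2.2, Fin.sum_univ_four, Fin.reduceEq, if_true, if_false, solderCoeff_dyad, hs,
      𝓕.covMetricVar_eq hnab]
    push_cast
    simp only [Fin.sum_univ_three]
    ring
  simp only [covDeriv, hcomp, Fin.prod_univ_four]
  refine (sum_fin_four_fun fun a b c d =>
    (𝓕.dyad 0 x).coord a (U 2) * (𝓕.dyad 0 x).coord b (U 3) * (𝓕.dyad 0 x).coord c (U 4) *
      (𝓕.dyad 0 x).coord d (U 5) * ∑ i, ∑ j, ivdw i a b * ivdw j c d *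
        (𝓕.covMetricVar nab x p i j : ℂ)).trans ?_
  simp only [solderCoeff, Fin.sum_univ_two, Fin.sum_univ_three]
  ring

/-! ### Variation of the spin connection -/

/-- The derivative of `r_{kl}` along `e_i`. -/
def rotVarDeriv (x : M) (i k l : Fin 3) : ℂ :=
  (((mvfderiv (𝓡 3) (𝓕.frameVar k l) x (𝓕.frame 0 x i) -
    mvfderiv (𝓡 3) (𝓕.frameVar l k) x (𝓕.frame 0 x i)) / 2 : ℝ) : ℂ)

theorem hasDirDeriv_rotVar (x : M) (i k l : Fin 3) :
    HasDirDeriv (fun y => 𝓕.rotVar y k l) x (𝓕.frame 0 x i) (𝓕.rotVarDeriv x i k l) := by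
  have h := (((HasDirDeriv.of_mdifferentiableAt (𝓕.mdifferentiableAt_frameVar k l x)
    (𝓕.frame 0 x i)).add ((HasDirDeriv.of_mdifferentiableAt (𝓕.mdifferentiableAt_frameVar l k x)
    (𝓕.frame 0 x i)).const_mul_real (-1))).const_mul_real (1 / 2)).ofReal
  have e : (fun y => 𝓕.rotVar y k l) = fun y =>
      (((1 / 2) * (𝓕.frameVar k l y + -1 * 𝓕.frameVar l k y) : ℝ) : ℂ) := by
    funext y
    rw [rotVar]
    congr 1
    ring
  rw [e]
  refine h.congr_deriv ?_
  rw [rotVarDeriv]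
  congr 1
  ring

/-- The variation of the spin connection coefficients: the image of `hasDerivAt_conn` under the
Lie algebra homomorphism `ρ`. -/
theorem hasDerivAt_spinConn
    {nab : ℝ → CovariantDerivative (𝓡 3) E3 (TangentSpace (𝓡 3) : M → Type)}
    (hnab : ∀ t, 𝓕.IsLeviCivita t (nab t)) {D : ℝ → CovariantDerivative (𝓡 3) C2 S}
    (hD : ∀ t, 𝓕.IsSpinConnection t (nab t) (D t)) (x : M) (i : Fin 3) (A B : Fin 2) :
    HasDerivAt (fun t => 𝓕.spinConn t (D t) x i A B)
      (∑ p, (𝓕.frameVar i p x : ℂ) * 𝓕.spinConn 0 (D 0) x p A B +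
        spinRep (𝓕.rotVarDeriv x i) A B +
        (∑ C, spinRep (𝓕.rotVar x) A C * 𝓕.spinConn 0 (D 0) x i C B -
          ∑ C, 𝓕.spinConn 0 (D 0) x i A C * spinRep (𝓕.rotVar x) C B) +
        spinRep (fun j k => (1 / 2) * (𝓕.covMetricVar (nab 0) x k j i : ℂ) -
          (1 / 2) * (𝓕.covMetricVar (nab 0) x j k i : ℂ)) A B) 0 := by
  simp only [fun t => (hD t).spinConn_eq (hnab t)]
  have hγ : ∀ i k l, (𝓕.conn 0 (nab 0) x i k l : ℂ) = -(𝓕.conn 0 (nab 0) x i l k : ℂ) := by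
    intro i k l
    rw [(hnab 0).conn_antisymm]
    push_cast
    rfl
  rw [← spinRep_lie (𝓕.rotVar_antisymm x) (hγ i), ← spinRep_sum_mul, ← spinRep_add, ← spinRep_add,
    ← spinRep_add]
  refine hasDerivAt_spinRep (fun j k => ?_) A B
  refine (𝓕.hasDerivAt_conn hnab x i j k).ofReal_comp.congr_deriv ?_
  have key : (1 / 2) * ((𝓕.covFrameVar (nab 0) x i j k : ℂ) - 𝓕.covFrameVar (nab 0) x i k j) =
      𝓕.rotVarDeriv x i j k + (∑ m, 𝓕.rotVar x j m * (𝓕.conn 0 (nab 0) x i m k : ℂ) -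
        ∑ m, (𝓕.conn 0 (nab 0) x i j m : ℂ) * 𝓕.rotVar x m k) := by
    simp only [covFrameVar, rotVarDeriv, rotVar]
    push_cast
    simp only [Fin.sum_univ_three, hγ i _ j, hγ i k]
    ring
  simp only [covMetricVar]
  push_cast
  linear_combination key

/-! ### Variation of the derivative of a covariant spinor -/

section

variable {nab : ℝ → CovariantDerivative (𝓡 3) E3 (TangentSpace (𝓡 3) : M → Type)}
  {D : ℝ → CovariantDerivative (𝓡 3) C2 S} {κ : ℝ → ∀ x, Dual ℂ (S x)}

/-- The components `κ_C` in the moving dyad. -/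
def comp (κ : ℝ → ∀ x, Dual ℂ (S x)) (C : Fin 2) (p : ℝ × M) : ℂ := κ p.1 p.2 (𝓕.dyad p.1 p.2 C)

theorem ofCovector_eq (κ : ℝ → ∀ x, Dual ℂ (S x)) (t : ℝ) (x : M) (U : Fin 1 → S x) :
    ofCovector (κ t) x U = ∑ C, (𝓕.dyad t x).coord C (U 0) * 𝓕.comp κ C (t, x) := by
  simp only [ofCovector]
  conv_lhs => rw [← (𝓕.dyad t x).sum_repr (U 0), map_sum]
  simp only [map_smul, smul_eq_mul]
  rfl

/-- The variation `δκ_C` of the components of `κ` in the moving dyad. -/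
def compVar (κ : ℝ → ∀ x, Dual ℂ (S x)) (C : Fin 2) (x : M) : ℂ :=
  deriv (fun t => 𝓕.comp κ C (t, x)) 0

/-- The components `D_i κ_C` in the moving frame and dyad. -/
def compDeriv (κ : ℝ → ∀ x, Dual ℂ (S x)) (D : CovariantDerivative (𝓡 3) C2 S) (t : ℝ) (x : M)
    (i : Fin 3) (C : Fin 2) : ℂ :=
  mvfderiv (𝓡 3) (fun y => 𝓕.comp κ C (t, y)) x (𝓕.frame t x i) -
    ∑ E, 𝓕.spinConn t D x i C E * 𝓕.comp κ E (t, x)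

theorem spinDeriv_ofCovector (κ : ℝ → ∀ x, Dual ℂ (S x)) (D : CovariantDerivative (𝓡 3) C2 S)
    (t : ℝ) (x : M) (U : Fin 3 → S x) :
    𝓕.spinDeriv t D (ofCovector (κ t)) x U = ∑ i, 𝓕.solderCoeff t x i (U 0) (U 1) *
      ∑ C, (𝓕.dyad t x).coord C (U 2) * 𝓕.compDeriv κ D t x i C :=
  𝓕.spinDeriv_one (fun y U => 𝓕.ofCovector_eq κ t y U) U

/-- The variation of the components `D_i κ_C`. -/
theorem hasDerivAt_compDeriv (hnab : ∀ t, 𝓕.IsLeviCivita t (nab t))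
    (hD : ∀ t, 𝓕.IsSpinConnection t (nab t) (D t))
    (hκ : ∀ C, ContMDiff (𝓘(ℝ, ℝ).prod (𝓡 3)) 𝓘(ℝ, ℂ) ∞ (𝓕.comp κ C))
    (x : M) (i : Fin 3) (C : Fin 2) :
    HasDerivAt (fun t => 𝓕.compDeriv κ (D t) t x i C)
      (∑ p, (𝓕.frameVar i p x : ℂ) *
          mvfderiv (𝓡 3) (fun y => 𝓕.comp κ C (0, y)) x (𝓕.frame 0 x p) +
        mvfderiv (𝓡 3) (𝓕.compVar κ C) x (𝓕.frame 0 x i) -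
        ∑ E, ((∑ p, (𝓕.frameVar i p x : ℂ) * 𝓕.spinConn 0 (D 0) x p C E +
          spinRep (𝓕.rotVarDeriv x i) C E +
          (∑ B, spinRep (𝓕.rotVar x) C B * 𝓕.spinConn 0 (D 0) x i B E -
            ∑ B, 𝓕.spinConn 0 (D 0) x i C B * spinRep (𝓕.rotVar x) B E) +
          spinRep (fun j k => (1 / 2) * (𝓕.covMetricVar (nab 0) x k j i : ℂ) -
            (1 / 2) * (𝓕.covMetricVar (nab 0) x j k i : ℂ)) C E) * 𝓕.comp κ E (0, x) +
          𝓕.spinConn 0 (D 0) x i C E * 𝓕.compVar κ E x)) 0 := by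
  have h1 : (fun t => mvfderiv (𝓡 3) (fun y => 𝓕.comp κ C (t, y)) x (𝓕.frame t x i)) =
      fun t => ∑ p, (𝓕.frameCoeff i p (t, x) : ℂ) *
        mvfderiv (𝓡 3) (fun y => 𝓕.comp κ C (t, y)) x (𝓕.frame 0 x p) := by
    funext t
    rw [𝓕.sum_frameCoeff t x i]
    simp only [map_sum, map_smul, Complex.real_smul]
  have h2 := HasDerivAt.fun_sum (u := Finset.univ) fun p _ =>
    (𝓕.hasDerivAt_frameCoeff i p x).ofReal_comp.fun_mul
      (hasDerivAt_mvfderiv_swap (hκ C) x (𝓕.frame 0 x p)).2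
  rw [← h1] at h2
  have h3 := HasDerivAt.fun_sum (u := Finset.univ) fun E _ =>
    (𝓕.hasDerivAt_spinConn hnab hD x i C E).fun_mul (differentiableAt_slice (hκ E) 0 x).hasDerivAt
  refine (h2.fun_sub h3).congr_deriv ?_
  congr 1
  rw [Finset.sum_add_distrib]
  congr 1
  simp only [frameCoeff_zero, apply_ite Complex.ofReal, Complex.ofReal_one, Complex.ofReal_zero,
    ite_mul, one_mul, zero_mul, Finset.sum_ite_eq, Finset.mem_univ, if_true]
  rfl

/-- `D_{AB} ϑκ_C` in components, where `ϑκ_C = δκ_C - ρ(r)_C^E κ_E`. -/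
theorem spinDeriv_modVar_ofCovector
    (hκ : ∀ C, ContMDiff (𝓘(ℝ, ℝ).prod (𝓡 3)) 𝓘(ℝ, ℂ) ∞ (𝓕.comp κ C))
    (D : CovariantDerivative (𝓡 3) C2 S) (x : M) (U : Fin 3 → S x) :
    𝓕.spinDeriv 0 D (𝓕.modVar (fun t => ofCovector (κ t))) x U =
      ∑ i, 𝓕.solderCoeff 0 x i (U 0) (U 1) * ∑ C, (𝓕.dyad 0 x).coord C (U 2) *
        ((mvfderiv (𝓡 3) (𝓕.compVar κ C) x (𝓕.frame 0 x i) -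
          ∑ E, (spinRep (𝓕.rotVarDeriv x i) C E * 𝓕.comp κ E (0, x) +
            spinRep (𝓕.rotVar x) C E *
              mvfderiv (𝓡 3) (fun y => 𝓕.comp κ E (0, y)) x (𝓕.frame 0 x i))) -
        ∑ E, 𝓕.spinConn 0 D x i C E *
          (𝓕.compVar κ E x - ∑ B, spinRep (𝓕.rotVar x) E B * 𝓕.comp κ B (0, x))) := by
  have h1 : ∀ y U, 𝓕.modVar (fun t => ofCovector (κ t)) y U =
      ∑ C, (𝓕.dyad 0 y).coord C (U 0) *
        (𝓕.compVar κ C y - ∑ E, spinRep (𝓕.rotVar y) C E * 𝓕.comp κ E (0, y)) := fun y U =>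
    𝓕.modVar_one (fun t U => 𝓕.ofCovector_eq κ t y U)
      (fun C => (differentiableAt_slice (hκ C) 0 y).hasDerivAt) U
  rw [𝓕.spinDeriv_one h1]
  refine Finset.sum_congr rfl fun i _ => ?_
  congr 1
  refine Finset.sum_congr rfl fun C _ => ?_
  congr 2
  have hk : ∀ E, HasDirDeriv (fun y => 𝓕.comp κ E (0, y)) x (𝓕.frame 0 x i)
      (mvfderiv (𝓡 3) (fun y => 𝓕.comp κ E (0, y)) x (𝓕.frame 0 x i)) := fun E =>
    .of_mdifferentiableAt (ContMDiff.mdifferentiableAt (n := ∞)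
      ((hκ E).comp (contMDiff_const.prodMk contMDiff_id)) (by simp)) _
  have hd := (HasDirDeriv.of_mdifferentiableAt
    (hasDerivAt_mvfderiv_swap (hκ C) x (𝓕.frame 0 x i)).1 (𝓕.frame 0 x i)).add
    ((HasDirDeriv.sum (s := Finset.univ) fun E _ =>
      (HasDirDeriv.spinRep (fun k l => 𝓕.hasDirDeriv_rotVar x i k l) C E).mul (hk E)).const_mul
        (-1))
  simp only [neg_one_mul, ← sub_eq_add_neg] at hd
  exact hd.2

/-- The term `𝒬_{ABCD} κ^D` is `- ρ(D_k s_{ij} - D_j s_{ik})` applied to `κ`. -/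
theorem sum_eps_Q {nab : CovariantDerivative (𝓡 3) E3 (TangentSpace (𝓡 3) : M → Type)}
    {D : CovariantDerivative (𝓡 3) C2 S} (hnab : 𝓕.IsLeviCivita 0 nab)
    (hD : 𝓕.IsSpinConnection 0 nab D) (x : M) (u v w : S x) (k : Fin 2 → ℂ) :
    ∑ A, ∑ B, epsSym A B * 𝓕.Q D x ![u, v, w, 𝓕.dyad 0 x A] * k B =
      ∑ i, 𝓕.solderCoeff 0 x i u v * ∑ C, (𝓕.dyad 0 x).coord C w *
        -∑ B, spinRep (fun j k => (1 / 2) * (𝓕.covMetricVar nab x k j i : ℂ) -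
          (1 / 2) * (𝓕.covMetricVar nab x j k i : ℂ)) C B * k B := by
  have h : ∀ i C B, spinRep (fun j k => (1 / 2) * (𝓕.covMetricVar nab x k j i : ℂ) -
      (1 / 2) * (𝓕.covMetricVar nab x j k i : ℂ)) C B = _ := fun i C B =>
    spinRep_antisymmetrize (fun p j => (1 / 2) * (𝓕.covMetricVar nab x p j i : ℂ)) C B
  simp only [h, Q, 𝓕.spinDeriv_deltaMetricSpinor hnab hD]
  simp only [Matrix.cons_val]
  simp only [solderCoeff_dyad]
  simp only [solderCoeff_dyad_right]
  generalize 𝓕.covMetricVar nab x = c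
  simp only [Fin.sum_univ_two, epsSym, Matrix.of_apply, Matrix.cons_val]
  simp only [Fin.sum_univ_three]
  ring

/-- The contraction `δh_{ABDF} Φ^{DF}_C` is `- σ^i_{AB} δh_{ij} Φ_{jC}`, where
`Φ_{DFC} = σ^m_{DF} Φ_{mC}`. -/
theorem sum_eps_deltaMetricSpinor (x : M) (u v w : S x) (Φ : Fin 3 → Fin 2 → ℂ) :
    ∑ A, ∑ B, ∑ G, ∑ H, epsSym A G * epsSym B H *
        𝓕.deltaMetricSpinor x ![u, v, 𝓕.dyad 0 x A, 𝓕.dyad 0 x B] *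
        (∑ m, 𝓕.solderCoeff 0 x m (𝓕.dyad 0 x G) (𝓕.dyad 0 x H) *
          ∑ C, (𝓕.dyad 0 x).coord C w * Φ m C) =
      ∑ i, 𝓕.solderCoeff 0 x i u v * ∑ C, (𝓕.dyad 0 x).coord C w *
        -∑ j, (𝓕.metricVar x i j : ℂ) * Φ j C := by
  have h : ∀ G : Fin 3 → ℂ, ∀ c : Fin 3 → ℂ,
      ∑ A, ∑ B, ∑ E, ∑ H, epsSym A E * epsSym B H * (∑ j, ivdw j A B * c j) *
        (∑ m, ivdw m E H * G m) = -∑ j, c j * G j := by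
    intro G c
    have e : ∑ A, ∑ B, ∑ E, ∑ H, epsSym A E * epsSym B H * (∑ j, ivdw j A B * c j) *
        (∑ m, ivdw m E H * G m) = ∑ j, ∑ m, (∑ A, ∑ B, ∑ E, ∑ H,
          epsSym A E * epsSym B H * ivdw j A B * ivdw m E H) * (c j * G m) := by
      simp only [Fin.sum_univ_two, Fin.sum_univ_three]
      ring
    rw [e]
    simp only [ivdw_contract, ite_mul, neg_one_mul, zero_mul, Finset.sum_ite_eq, Finset.mem_univ,
      if_true, Finset.sum_neg_distrib]
  have h' := h (fun m => ∑ C, (𝓕.dyad 0 x).coord C w * Φ m C)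
    (fun j => ∑ i, 𝓕.solderCoeff 0 x i u v * (𝓕.metricVar x i j : ℂ))
  have e : ∀ A B, 𝓕.deltaMetricSpinor x ![u, v, 𝓕.dyad 0 x A, 𝓕.dyad 0 x B] =
      ∑ j, ivdw j A B * ∑ i, 𝓕.solderCoeff 0 x i u v * (𝓕.metricVar x i j : ℂ) := by
    intro A B
    simp only [deltaMetricSpinor_eq, Matrix.cons_val, solderCoeff_dyad, Finset.mul_sum]
    rw [Finset.sum_comm]
    exact Finset.sum_congr rfl fun j _ => Finset.sum_congr rfl fun i _ => by ring
  simp only [e, solderCoeff_dyad, h']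
  simp only [Fin.sum_univ_two, Fin.sum_univ_three]
  ring

end

end Family

end SpaceSpinor

end

open scoped Manifold ContDiff in
open Module SpaceSpinor in
theorem theorem3
    {M : Type*} [TopologicalSpace M] [ChartedSpace E3 M] [IsManifold (𝓡 3) ∞ M]
    {S : M → Type*} [∀ x, AddCommGroup (S x)] [∀ x, Module ℂ (S x)]
    [∀ x, TopologicalSpace (S x)] [TopologicalSpace (Bundle.TotalSpace C2 S)]
    [∀ x, IsTopologicalAddGroup (S x)] [∀ x, ContinuousSMul ℝ (S x)]
    [FiberBundle C2 S] [VectorBundle ℂ C2 S] [VectorBundle ℝ C2 S]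
    [ContMDiffVectorBundle ∞ C2 S (𝓡 3)]
    (𝓕 : Family M S)
    (nab : ℝ → CovariantDerivative (𝓡 3) E3 (TangentSpace (𝓡 3) : M → Type))
    (hnab : ∀ t, 𝓕.IsLeviCivita t (nab t))
    (D : ℝ → CovariantDerivative (𝓡 3) C2 S)
    (hD : ∀ t, 𝓕.IsSpinConnection t (nab t) (D t))
    (κ : ℝ → ∀ x, Dual ℂ (S x))
    (hκ : ∀ A, ContMDiff (𝓘(ℝ, ℝ).prod (𝓡 3)) 𝓘(ℝ, ℂ) ∞
      (fun p : ℝ × M => κ p.1 p.2 (𝓕.dyad p.1 p.2 A)))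
    (x : M) (u v w : S x) :
    𝓕.modVar (fun t => 𝓕.spinDeriv t (D t) (ofCovector (κ t))) x ![u, v, w] =
      𝓕.spinDeriv 0 (D 0) (𝓕.modVar (fun t => ofCovector (κ t))) x ![u, v, w]
      + ∑ A, ∑ B, epsSym A B * 𝓕.Q (D 0) x ![u, v, w, 𝓕.dyad 0 x A] * κ 0 x (𝓕.dyad 0 x B)
      - (1 / 2) * ∑ A, ∑ B, ∑ G, ∑ H, epsSym A G * epsSym B H *
          𝓕.deltaMetricSpinor x ![u, v, 𝓕.dyad 0 x A, 𝓕.dyad 0 x B] *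
          𝓕.spinDeriv 0 (D 0) (ofCovector (κ 0)) x ![𝓕.dyad 0 x G, 𝓕.dyad 0 x H, w] := by
  rw [𝓕.modVar_three (fun t U => 𝓕.spinDeriv_ofCovector κ (D t) t x U)
    (fun i C => 𝓕.hasDerivAt_compDeriv hnab hD hκ x i C), 𝓕.spinDeriv_modVar_ofCovector hκ,
    𝓕.sum_eps_Q (hnab 0) (hD 0) x u v w (fun B => κ 0 x (𝓕.dyad 0 x B))]
  simp only [Family.spinDeriv_ofCovector]
  simp only [Matrix.cons_val]
  rw [Family.sum_eps_deltaMetricSpinor]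
  have hk : ∀ B, κ 0 x (𝓕.dyad 0 x B) = 𝓕.comp κ B (0, x) := fun _ => rfl
  simp only [hk]
  rw [Finset.mul_sum, ← Finset.sum_add_distrib, ← Finset.sum_sub_distrib]
  refine Finset.sum_congr rfl fun i _ => ?_
  rw [mul_left_comm, ← mul_add, ← mul_sub]
  congr 1
  rw [Finset.mul_sum, ← Finset.sum_add_distrib, ← Finset.sum_sub_distrib]
  refine Finset.sum_congr rfl fun C _ => ?_
  rw [mul_left_comm, ← mul_add, ← mul_sub]
  congr 1
  simp only [Family.compDeriv, Family.metricVar, Family.rotVar]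
  push_cast
  generalize spinRep (fun j k => (1 / 2) * (𝓕.covMetricVar (nab 0) x k j i : ℂ) -
    (1 / 2) * (𝓕.covMetricVar (nab 0) x j k i : ℂ)) = m
  generalize spinRep (𝓕.rotVarDeriv x i) = R'
  simp only [Fin.sum_univ_two, Fin.sum_univ_three]
  ring
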